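/- Let $X$ be a complex Banach space, $T$ a bounded linear operator on $X$, and let $\sigma_*$ be one of the spectrum $\sigma$, the Browder spectrum $\sigma_b(T)=\{\lambda\in\mathbb C: T-\lambda I \text{ is not a Fredholm operator of finite ascent and descent}\}$, or the Drazin spectrum $\sigma_d(T)=\{\lambda\in\mathbb C: T-\lambda I\text{ is not Drazin invertible}\}$, where $T$ is Drazin invertible if there are a bounded operator $R$ and $n\ge 0$ with $TR=RT$, $RTR=R$ and $T^{n+1}R=T^n$. For $A\subset\mathbb C$ let $\mathrm{acc}\,A$ be the set of accumulation points of $A$, and define the Cantor--Bendixson derivatives by $\mathrm{acc}^0A=A$, $\mathrm{acc}^{\beta+1}A=\mathrm{acc}(\mathrm{acc}^{\beta}A)$, and $\mathrm{acc}^{\alpha}A=\bigcap_{\beta<\alpha}\mathrm{acc}^{\beta}A$ for limit ordinals $\alpha$. Call a bounded operator $T$ on a complex Banach space $X$ $g^{\alpha}_{\sigma_*}$-invertible if - $\alpha=0$ and $0\notin\sigma_*(T)$; or - $\alpha=\beta+1$ is a successor ordinal and there are closed $T$-invariant subspaces $M,N$ with $X=M\oplus N$ such that the restriction $T_M$ is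 invertible and $\mathrm{acc}^{\beta}\,\sigma_*(T_N)\subset\{0\}$; or - $\alpha$ is a limit ordinal and $T$ is $g^{\beta}_{\sigma_*}$-invertible for some successor ordinal $\beta<\alpha$. Then for every ordinal $\alpha$: 1. $T$ is $g^{\alpha}_{\sigma_*}$-invertible if and only if its dual adjoint $T^*$, acting on the dual space $X^*$, is $g^{\alpha}_{\sigma_*}$-invertible. 2. If $S$ is a bounded operator on a complex Banach space $Y$, then $S\oplus T$ is $g^{\alpha}_{\sigma_*}$-invertible if and only if both $S$ and $T$ are $g^{\alpha}_{\sigma_*}$-invertible. 3. $T$ is $g^{\alpha}_{\sigma_*}$-invertible if and only if $T^m$ is $g^{\alpha}_{\sigma_*}$-invertible for some integer $m\ge1$; equivalently, if and only if $T^m$ is $g^{\alpha}_{\sigma_*}$-invertible for every integer $m\ge1$. -/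

import Mathlib

universe u v w

noncomputable section

namespace GInv

/-- The transfinite Cantor-Bendixson derivative `acc^α A` of a set of complex numbers:
`acc^0 A = A`, `acc^(α+1) A = acc (acc^α A)`, and `acc^α A = ⋂ β < α, acc^β A` at limits, where
`acc B` (Mathlib's `derivedSet B`) is the set of all accumulation points of `B` in `ℂ`.
Ordinals of every universe are allowed. -/
def accIter (A : Set ℂ) (α : Ordinal.{w}) : Set ℂ :=
  Ordinal.limitRecOn (motive := fun _ => Set ℂ) α A
    (fun _ B => derivedSet B)
    (fun α _ B => ⋂ (β : Ordinal.{w}) (h : β < α), B β h)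

section Operators

variable {X : Type u} [NormedAddCommGroup X] [NormedSpace ℂ X]

/-- `T` has finite ascent: the chain of kernels of the powers of `T` becomes stationary. -/
def HasFiniteAscent (T : X →L[ℂ] X) : Prop :=
  ∃ n : ℕ, (T ^ n).ker = (T ^ (n + 1)).ker

/-- `T` has finite descent: the chain of ranges of the powers of `T` becomes stationary. -/
def HasFiniteDescent (T : X →L[ℂ] X) : Prop :=
  ∃ n : ℕ, (T ^ n).range = (T ^ (n + 1)).range

/-- `T` is a Browder operator: a Fredholm operator of finite ascent and finite descent. -/
def IsBrowder (T : X →L[ℂ] X) : Prop :=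
  T.IsFredholm ∧ HasFiniteAscent T ∧ HasFiniteDescent T

/-- `T` is Drazin invertible: there is a bounded operator `S` (the Drazin inverse) with
`T S = S T`, `S T S = S` and `T ^ (n + 1) S = T ^ n` for some `n`. -/
def IsDrazinInvertible (T : X →L[ℂ] X) : Prop :=
  ∃ S : X →L[ℂ] X, Commute T S ∧ S * T * S = S ∧ ∃ n : ℕ, T ^ (n + 1) * S = T ^ n

end Operators

/-- The three spectra `σ`, `σ_b`, `σ_d` over which `σ_*` ranges. -/
inductive SpectrumKind
  | full
  | browder
  | drazin

/-- `σ_*(T)`: the spectrum `σ(T)`, the Browder spectrum `σ_b(T)` or the Drazin spectrum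
`σ_d(T)`. -/
def sigmaStar (s : SpectrumKind) {X : Type u} [NormedAddCommGroup X] [NormedSpace ℂ X]
    (T : X →L[ℂ] X) : Set ℂ :=
  match s with
  | .full => spectrum ℂ T
  | .browder => {z : ℂ | ¬ IsBrowder (T - z • (1 : X →L[ℂ] X))}
  | .drazin => {z : ℂ | ¬ IsDrazinInvertible (T - z • (1 : X →L[ℂ] X))}

section GInvertible

variable {X : Type u} [NormedAddCommGroup X] [NormedSpace ℂ X]

/-- `(M, N) ∈ Red(T)`: `M` and `N` are closed `T`-invariant subspaces and `X = M ⊕ N`. -/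
structure IsRed (T : X →L[ℂ] X) (M N : Submodule ℂ X) : Prop where
  isClosed_left : IsClosed (M : Set X)
  isClosed_right : IsClosed (N : Set X)
  invariant_left : ∀ x ∈ M, T x ∈ M
  invariant_right : ∀ x ∈ N, T x ∈ N
  isCompl : IsCompl M N

/-- The condition at the successor ordinal `β + 1`: for some `(M, N) ∈ Red(T)` the restriction
`T_M` is invertible and `acc^β σ_*(T_N) ⊆ {0}`. -/
def IsGInvertibleSucc (s : SpectrumKind) (β : Ordinal.{w}) (T : X →L[ℂ] X) : Prop :=
  ∃ (M N : Submodule ℂ X) (h : IsRed T M N),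
    IsUnit (T.restrict h.invariant_left) ∧
      accIter (sigmaStar s (T.restrict h.invariant_right)) β ⊆ {0}

/-- `T` is `g^α_{σ_*}`-invertible:
* `α = 0`: `0 ∉ σ_*(T)`;
* `α = β + 1`: there is `(M, N) ∈ Red(T)` with `T_M` invertible and `acc^β σ_*(T_N) ⊆ {0}`;
* `α` a limit: `T` is `g^(β + 1)_{σ_*}`-invertible for some ordinal `β` with `β + 1 < α`. -/
def IsGInvertible (s : SpectrumKind) (α : Ordinal.{w}) (T : X →L[ℂ] X) : Prop :=
  Ordinal.limitRecOn (motive := fun _ => Prop) α ((0 : ℂ) ∉ sigmaStar s T)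
    (fun β _ => IsGInvertibleSucc s β T)
    (fun α _ _ => ∃ β : Ordinal.{w}, β + 1 < α ∧ IsGInvertibleSucc s β T)

/-- The dual adjoint `T* : X* → X*`, `f ↦ f ∘ T`, on the space of continuous linear functionals
on `X`. -/
def dualAdjoint (T : X →L[ℂ] X) : StrongDual ℂ X →L[ℂ] StrongDual ℂ X :=
  ContinuousLinearMap.precomp ℂ T

end GInvertible

end GInv

end

/-!
An operator `T` is `g^α_{σ_*}`-invertible if and only if `0 ∉ acc^α σ_*(T)`. The only substantial
direction is at a successor `α = β + 1`: if `0` is not an accumulation point of `acc^β σ_*(T)`, then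
`σ(T)` is countable near `0`, so some arbitrarily small circle around `0` avoids it, and the Riesz
idempotent of that circle splits `X` as required. In place of a contour integral, this idempotent is
obtained as the limit of `(1 - b ^ 2 ^ k)⁻¹`, where `b` is a multiple of `T` for which the circle is
the unit circle.

It remains to know how `σ_*` and `acc^α` behave under adjoints, direct sums and powers. All three
spectra are treated at once: `z ∉ σ_*(T)` says that `T - z` is Drazin invertible with residue
`1 - (T - z) S` in the ideal `0`, the finite rank operators, or everything. This notion makes sense
in a ring, where its behaviour under products and powers is algebra.
-/

namespace GInv

open Filter Topology Set Polynomial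

section CantorBendixson

lemma derivedSet_image_subset {X Y : Type*} [TopologicalSpace X] [TopologicalSpace Y] [T2Space Y]
    {f : X → Y} (hf : Continuous f) {A : Set X} (hA : IsCompact A) :
    derivedSet (f '' A) ⊆ f '' derivedSet A := by
  intro w hw
  let F : Filter X := comap f (𝓝[≠] w) ⊓ 𝓟 A
  have hmap : map f F = 𝓝[≠] w ⊓ 𝓟 (f '' A) := by rw [Filter.push_pull', map_principal]
  have : NeBot F := by
    rw [← map_neBot_iff f, hmap]
    exact hw
  obtain ⟨z, -, hz⟩ := hA (inf_le_right : F ≤ 𝓟 A)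
  have hzw : f z = w := by
    have h : ClusterPt (f z) (map f F) := hz.map hf.continuousAt tendsto_map
    exact eq_of_nhds_neBot (h.mono (hmap.le.trans (inf_le_left.trans nhdsWithin_le_nhds)))
  have hF : F ≤ 𝓟 (A \ {z}) := by
    have h : f ⁻¹' {w}ᶜ ∈ F :=
      mem_inf_of_left (preimage_mem_comap self_mem_nhdsWithin)
    refine le_principal_iff.2 (mem_of_superset (inter_mem (mem_inf_of_right (mem_principal_self A))
      h) fun y hy => ⟨hy.1, ?_⟩)
    rintro rfl
    exact hy.2 hzw
  exact ⟨z, accPt_principal_iff_clusterPt.2 (hz.mono hF), hzw⟩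

lemma image_derivedSet_subset {X Y : Type*} [TopologicalSpace X] [T1Space X] [TopologicalSpace Y]
    {f : X → Y} (hf : Continuous f) (hfin : ∀ w, (f ⁻¹' {w}).Finite) (A : Set X) :
    f '' derivedSet A ⊆ derivedSet (f '' A) := by
  rintro _ ⟨z, hz, rfl⟩
  have hne : ∀ᶠ y in 𝓝[≠] z, f y ≠ f z := by
    have h : (f ⁻¹' {f z} \ {z})ᶜ ∈ 𝓝 z :=
      (hfin (f z)).sdiff.isClosed.isOpen_compl.mem_nhds fun h => h.2 rfl
    filter_upwards [nhdsWithin_le_nhds h, self_mem_nhdsWithin] with y hy hyz hfy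
    exact hy ⟨hfy, hyz⟩
  have hpunctured : Tendsto f (𝓝[≠] z) (𝓝[≠] f z) :=
    tendsto_nhdsWithin_iff.2 ⟨hf.continuousAt.mono_left nhdsWithin_le_nhds, hne⟩
  have : NeBot (𝓝[≠] z ⊓ 𝓟 A) := hz
  exact ((hpunctured.inf (tendsto_principal_principal.2 fun _ => mem_image_of_mem f))).neBot

lemma derivedSet_image {X Y : Type*} [TopologicalSpace X] [T1Space X] [TopologicalSpace Y]
    [T2Space Y] {f : X → Y} (hf : Continuous f) (hfin : ∀ w, (f ⁻¹' {w}).Finite) {A : Set X}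
    (hA : IsCompact A) : derivedSet (f '' A) = f '' derivedSet A :=
  (derivedSet_image_subset hf hA).antisymm (image_derivedSet_subset hf hfin A)

lemma accIter_zero (A : Set ℂ) : accIter A (0 : Ordinal.{w}) = A :=
  Ordinal.limitRecOn_zero ..

lemma accIter_add_one (A : Set ℂ) (β : Ordinal.{w}) :
    accIter A (β + 1) = derivedSet (accIter A β) :=
  Ordinal.limitRecOn_add_one ..

lemma accIter_limit (A : Set ℂ) {α : Ordinal.{w}} (hα : Order.IsSuccLimit α) :
    accIter A α = ⋂ β : Iio α, accIter A β :=
  (Ordinal.limitRecOn_limit _ _ _ _ hα).trans (biInter_eq_iInter (Iio α) fun β _ => accIter A β)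

lemma accIter_mono {A B : Set ℂ} (h : A ⊆ B) (α : Ordinal.{w}) :
    accIter A α ⊆ accIter B α := by
  induction α using Ordinal.limitRecOn with
  | zero => simpa only [accIter_zero]
  | add_one β ih =>
    rw [accIter_add_one, accIter_add_one]
    exact derivedSet_mono _ _ ih
  | limit α hα ih =>
    rw [accIter_limit A hα, accIter_limit B hα]
    exact iInter_mono fun β => ih β β.2

lemma isClosed_accIter {A : Set ℂ} (hA : IsClosed A) (α : Ordinal.{w}) :
    IsClosed (accIter A α) := by
  induction α using Ordinal.limitRecOn with
  | zero => rwa [accIter_zero]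
  | add_one β =>
    rw [accIter_add_one]
    exact isClosed_derivedSet _
  | limit α hα ih =>
    rw [accIter_limit A hα]
    exact isClosed_iInter fun β => ih β β.2

lemma accIter_antitone {A : Set ℂ} (hA : IsClosed A) :
    Antitone (accIter A : Ordinal.{w} → Set ℂ) := by
  intro β α h
  induction α using Ordinal.limitRecOn with
  | zero => rw [nonpos_iff_eq_zero.1 h]
  | add_one γ ih =>
    rcases h.lt_or_eq with h | rfl
    · rw [accIter_add_one]
      exact ((isClosed_iff_derivedSet_subset _).1 (isClosed_accIter hA γ)).trans
        (ih (Order.lt_add_one_iff.1 h))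
    · rfl
  | limit α hα =>
    rcases h.lt_or_eq with h | rfl
    · rw [accIter_limit A hα]
      exact iInter_subset (fun β : Iio α => accIter A β) ⟨β, h⟩
    · rfl

lemma accIter_subset {A : Set ℂ} (hA : IsClosed A) (α : Ordinal.{w}) : accIter A α ⊆ A := by
  simpa only [accIter_zero] using accIter_antitone hA (zero_le : 0 ≤ α)

lemma accIter_union {A B : Set ℂ} (hA : IsClosed A) (hB : IsClosed B) (α : Ordinal.{w}) :
    accIter (A ∪ B) α = accIter A α ∪ accIter B α := by
  induction α using Ordinal.limitRecOn with
  | zero => simp only [accIter_zero]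
  | add_one β ih => simp only [accIter_add_one, ih, derivedSet_union]
  | limit α hα ih =>
    simp only [accIter_limit _ hα]
    rw [iInter_congr fun β : Iio α => ih β β.2]
    exact iInter_union_of_antitone (fun _ _ h => accIter_antitone hA h)
      (fun _ _ h => accIter_antitone hB h)

lemma accIter_image {A : Set ℂ} (hA : IsCompact A) {f : ℂ → ℂ} (hf : Continuous f)
    (hfin : ∀ w, (f ⁻¹' {w}).Finite) (α : Ordinal.{w}) :
    accIter (f '' A) α = f '' accIter A α := by
  have hcompact (β : Ordinal.{w}) : IsCompact (accIter A β) :=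
    hA.of_isClosed_subset (isClosed_accIter hA.isClosed β) (accIter_subset hA.isClosed β)
  induction α using Ordinal.limitRecOn with
  | zero => simp only [accIter_zero]
  | add_one β ih => rw [accIter_add_one, accIter_add_one, ih, derivedSet_image hf hfin (hcompact β)]
  | limit α hα ih =>
    have : Nonempty (Iio α) := ⟨⟨0, hα.bot_lt⟩⟩
    rw [accIter_limit _ hα, accIter_limit _ hα, iInter_congr fun β : Iio α => ih β β.2]
    refine Subset.antisymm (fun w hw => ?_) (image_iInter_subset _ _)
    obtain ⟨z, hz⟩ := IsCompact.nonempty_iInter_of_directed_nonempty_isCompact_isClosed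
      (fun β : Iio α => accIter A β ∩ f ⁻¹' {w})
      (Antitone.directed_ge fun β γ h => inter_subset_inter_left _ (accIter_antitone hA.isClosed h))
      (fun β => let ⟨z, hz, hzw⟩ := mem_iInter.1 hw β; ⟨z, hz, hzw⟩)
      (fun β => (hcompact β).inter_right (isClosed_singleton.preimage hf))
      (fun β => (isClosed_accIter hA.isClosed β).inter (isClosed_singleton.preimage hf))
    rw [mem_iInter] at hz
    exact ⟨z, mem_iInter.2 fun β => (hz β).1, (hz ⟨0, hα.bot_lt⟩).2⟩

lemma accIter_image_pow {A : Set ℂ} (hA : IsCompact A) {m : ℕ} (hm : m ≠ 0)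
    (α : Ordinal.{w}) : accIter ((· ^ m) '' A) α = (· ^ m) '' accIter A α := by
  refine accIter_image hA (continuous_pow m) (fun w => ?_) α
  refine (nthRoots m w).toFinset.finite_toSet.subset fun z hz => ?_
  simpa [mem_nthRoots (Nat.pos_of_ne_zero hm)] using hz

lemma subset_accIter_of_preperfect {D : Set ℂ} (hD : Preperfect D) (α : Ordinal.{w}) :
    D ⊆ accIter D α := by
  induction α using Ordinal.limitRecOn with
  | zero => rw [accIter_zero]
  | add_one β ih =>
    rw [accIter_add_one]
    exact (preperfect_iff_subset_derivedSet.1 hD).trans (derivedSet_mono _ _ ih)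
  | limit α hα ih =>
    rw [accIter_limit _ hα]
    exact subset_iInter fun β => ih β β.2

lemma countable_diff_accIter {A : Set ℂ} (hA : IsClosed A) (α : Ordinal.{w}) :
    (A \ accIter A α).Countable := by
  obtain ⟨V, D, hV, hD, hVD⟩ := exists_countable_union_perfect_of_isClosed hA
  refine hV.mono fun x ⟨hx, hxα⟩ => (hVD ▸ hx).resolve_right fun hxD => hxα ?_
  exact accIter_mono (hVD ▸ subset_union_right) α (subset_accIter_of_preperfect hD.acc α hxD)

end CantorBendixson

section Ring

variable {R : Type*} [Ring R]

/-- The element which, for an idempotent `e` commuting with `x` and `y`, acts as `x` on the summand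
cut out by `1 - e` and as `y` on the summand cut out by `e`. -/
def peirceGlue (e x y : R) : R :=
  x * (1 - e) + y * e

lemma peirceGlue_self (e x : R) : peirceGlue e x x = x := by
  rw [peirceGlue, ← mul_add, sub_add_cancel, mul_one]

lemma commute_peirceGlue {c e x y : R} (he : Commute c e) (hx : Commute c x) (hy : Commute c y) :
    Commute c (peirceGlue e x y) :=
  (hx.mul_right ((Commute.one_right c).sub_right he)).add_right (hy.mul_right he)

lemma peirceGlue_mul {e x x' y y' : R} (he : IsIdempotentElem e) (hx' : Commute x' e)
    (hy' : Commute y' e) :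
    peirceGlue e x y * peirceGlue e x' y' = peirceGlue e (x * x') (y * y') := by
  have hx : (1 - e) * x' = x' * (1 - e) := ((Commute.one_left x').sub_left hx'.symm).eq
  have hy : (1 - e) * y' = y' * (1 - e) := ((Commute.one_left y').sub_left hy'.symm).eq
  calc (x * (1 - e) + y * e) * (x' * (1 - e) + y' * e)
    _ = x * ((1 - e) * x') * (1 - e) + x * ((1 - e) * y') * e
          + (y * (e * x') * (1 - e) + y * (e * y') * e) := by
      noncomm_ring
    _ = x * x' * ((1 - e) * (1 - e)) + x * y' * ((1 - e) * e)
          + (y * x' * (e * (1 - e)) + y * y' * (e * e)) := by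
      simp only [hx, hy, ← hx'.eq, ← hy'.eq, mul_assoc]
    _ = peirceGlue e (x * x') (y * y') := by
      rw [he.one_sub.eq, he.eq, he.one_sub_mul_self, he.mul_one_sub_self, mul_zero, mul_zero,
        add_zero, zero_add, peirceGlue]

lemma peirceGlue_pow {e x y : R} (he : IsIdempotentElem e) (hx : Commute x e) (hy : Commute y e)
    (n : ℕ) : peirceGlue e x y ^ n = peirceGlue e (x ^ n) (y ^ n) := by
  induction n with
  | zero => simp only [pow_zero, peirceGlue_self]
  | succ n ih => rw [pow_succ, ih, peirceGlue_mul he hx hy, ← pow_succ, ← pow_succ]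

lemma isUnit_peirceGlue {e x y : R} (he : IsIdempotentElem e) (hxe : Commute x e)
    (hye : Commute y e) (hx : IsUnit x) (hy : IsUnit y) : IsUnit (peirceGlue e x y) := by
  obtain ⟨x, rfl⟩ := hx
  obtain ⟨y, rfl⟩ := hy
  refine ⟨⟨peirceGlue e x y, peirceGlue e ↑x⁻¹ ↑y⁻¹, ?_, ?_⟩, rfl⟩
  · rw [peirceGlue_mul he hxe.units_inv_left hye.units_inv_left, x.mul_inv, y.mul_inv,
      peirceGlue_self]
  · rw [peirceGlue_mul he hxe hye, x.inv_mul, y.inv_mul, peirceGlue_self]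

lemma isUnit_peirceGlue_one {a b e : R} (he : IsIdempotentElem e) (hab : Commute a b)
    (hae : Commute a e) (hbe : Commute b e) (h : a * b * (1 - e) = 1 - e) :
    IsUnit (peirceGlue e a 1) := by
  have hone : peirceGlue e (a * b) 1 = 1 := by rw [peirceGlue, h, one_mul, sub_add_cancel]
  refine ⟨⟨peirceGlue e a 1, peirceGlue e b 1, ?_, ?_⟩, rfl⟩
  · rw [peirceGlue_mul he hbe (Commute.one_left e), one_mul, hone]
  · rw [peirceGlue_mul he hae (Commute.one_left e), one_mul, ← hab.eq, hone]

lemma exists_mul_eq_one_sub {a e : R} (he : IsIdempotentElem e) (hae : Commute a e)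
    (h : IsUnit (peirceGlue e a 1)) :
    ∃ b, a * b = 1 - e ∧ b * (1 - e) = b ∧ ∀ c, Commute a c → Commute e c → Commute b c := by
  obtain ⟨u, hu⟩ := h
  have hcomm {c : R} (hac : Commute a c) (hec : Commute e c) : Commute ↑u⁻¹ c := by
    refine Commute.units_inv_left ?_
    rw [hu]
    exact (commute_peirceGlue hec.symm hac.symm (Commute.one_right c)).symm
  have hue : ↑u * (1 - e) = a * (1 - e) := by
    rw [hu, peirceGlue, add_mul, one_mul, he.mul_one_sub_self, mul_assoc, he.one_sub.eq, add_zero]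
  refine ⟨↑u⁻¹ * (1 - e), ?_, by rw [mul_assoc, he.one_sub.eq], fun c hac hec =>
    (hcomm hac hec).mul_left ((Commute.one_left c).sub_left hec)⟩
  rw [← mul_assoc, ← (hcomm (Commute.refl a) hae.symm).eq, mul_assoc, ← hue, u.inv_mul_cancel_left]

/-- `a` is Drazin invertible with residue in the ideal `J`: it has a commuting inverse `b` up to an
element `1 - a * b` of `J` which is killed by a power of `a`. For `J = ⊥` this is invertibility, for
`J = ⊤` Drazin invertibility, and for the finite rank operators it is the Browder property; the
normalisation `b * a * b = b` is left out as it can be achieved by changing `b`. -/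
def IsDrazinInvertibleMod (J : TwoSidedIdeal R) (a : R) : Prop :=
  ∃ b, Commute a b ∧ (∃ n, a ^ n * (1 - a * b) = 0) ∧ 1 - a * b ∈ J

lemma pow_mul_eq_zero_of_le {a e : R} {n m : ℕ} (h : a ^ n * e = 0) (hnm : n ≤ m) :
    a ^ m * e = 0 := by
  rw [← Nat.sub_add_cancel hnm, pow_add, mul_assoc, h, mul_zero]

lemma commute_one_sub_mul {a b c : R} (hab : Commute a b) (ha : a * (1 - a * b) = 0)
    (hac : Commute a c) : Commute (1 - a * b) c := by
  set e := 1 - a * b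
  have hab' : a * b = 1 - e := (sub_sub_cancel 1 (a * b)).symm
  have hea : e * a = 0 := by
    rw [← ((Commute.one_right a).sub_right ((Commute.refl a).mul_right hab)).eq, ha]
  have hleft : e * c * (1 - e) = 0 := by
    rw [← hab', mul_assoc, ← mul_assoc c, ← hac.eq, mul_assoc a, ← mul_assoc, hea, zero_mul]
  have hright : (1 - e) * c * e = 0 := by
    rw [← hab', hab.eq, mul_assoc b, hac.eq, mul_assoc, mul_assoc c, ha, mul_zero, mul_zero]
  calc e * c = e * c * e := by rwa [mul_sub, mul_one, sub_eq_zero] at hleft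
    _ = c * e := by rwa [sub_mul, sub_mul, one_mul, sub_eq_zero, eq_comm] at hright

namespace IsDrazinInvertibleMod

variable {J K : TwoSidedIdeal R} {a b e : R}

lemma exists_idempotent (h : IsDrazinInvertibleMod J a) :
    ∃ e ∈ J, IsIdempotentElem e ∧ (∀ c, Commute a c → Commute e c) ∧ (∃ n, a ^ n * e = 0) ∧
      IsUnit (peirceGlue e a 1) := by
  obtain ⟨b, hab, ⟨n, hn⟩, hJ⟩ := h
  have hfix : a ^ n * (a * b) = a ^ n := by rwa [mul_sub, mul_one, sub_eq_zero, eq_comm] at hn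
  have hfix_pow (k : ℕ) : a ^ n * (a * b) ^ k = a ^ n := by
    induction k with
    | zero => rw [pow_zero, mul_one]
    | succ k ih => rw [pow_succ, ← mul_assoc, ih, hfix]
  obtain ⟨p, hp⟩ : ∃ p, p = a ^ n * b ^ n := ⟨_, rfl⟩
  have hpow : (a * b) ^ n = p := hp ▸ hab.mul_pow n
  have hap : a ^ n * p = a ^ n := hpow ▸ hfix_pow n
  have hpp : IsIdempotentElem p := by
    have hp' : p = b ^ n * a ^ n := hp.trans (hab.pow_pow n n).eq
    calc p * p = b ^ n * (a ^ n * p) := by rw [← mul_assoc, ← hp']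
      _ = p := by rw [hap, ← hp']
  have hcomm (c : R) (hc : Commute a c) : Commute (1 - p) c :=
    hp ▸ commute_one_sub_mul (hab.pow_pow n n) (by rw [← hp, mul_sub, mul_one, hap, sub_self])
      (hc.pow_left n)
  refine ⟨1 - p, ?_, hpp.one_sub, hcomm, ⟨n, by rw [mul_sub, mul_one, hap, sub_self]⟩,
    isUnit_peirceGlue_one hpp.one_sub hab (hcomm a (Commute.refl a)).symm (hcomm b hab).symm ?_⟩
  · rw [← hpow, ← mul_neg_geom_sum]
    exact J.mul_mem_right _ _ hJ
  · rw [sub_sub_cancel, hp, ← mul_assoc, ← ((Commute.refl a).mul_right hab).pow_left n |>.eq, hfix]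

lemma exists_drazinInverse (h : IsDrazinInvertibleMod J a) :
    ∃ b, (∀ c, Commute a c → Commute b c) ∧ b * a * b = b ∧ (∃ n, a ^ n * (1 - a * b) = 0) ∧
      1 - a * b ∈ J := by
  obtain ⟨e, heJ, he, hcomm, hn, hu⟩ := h.exists_idempotent
  obtain ⟨b, hab, hbe, hb⟩ := exists_mul_eq_one_sub he (hcomm a (Commute.refl a)).symm hu
  refine ⟨b, fun c hc => hb c hc (hcomm c hc), ?_, ?_⟩
  · rw [mul_assoc, hab, hbe]
  · rw [hab, sub_sub_cancel]
    exact ⟨hn, heJ⟩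

lemma of_idempotent (heJ : e ∈ J) (he : IsIdempotentElem e) (hae : Commute a e) {n : ℕ}
    (hn : a ^ n * e = 0) (hu : IsUnit (peirceGlue e a 1)) : IsDrazinInvertibleMod J a := by
  obtain ⟨b, hab, -, hb⟩ := exists_mul_eq_one_sub he hae hu
  refine ⟨b, (hb a (Commute.refl a) hae.symm).symm, ?_⟩
  rw [hab, sub_sub_cancel]
  exact ⟨⟨n, hn⟩, heJ⟩

lemma mono (hJK : J ≤ K) : IsDrazinInvertibleMod J a → IsDrazinInvertibleMod K a
  | ⟨b, hab, hn, hJ⟩ => ⟨b, hab, hn, hJK hJ⟩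

lemma one : IsDrazinInvertibleMod J (1 : R) :=
  ⟨1, Commute.refl 1, ⟨0, by rw [mul_one, sub_self, mul_zero]⟩,
    by rw [mul_one, sub_self]; exact J.zero_mem⟩

lemma mul (ha : IsDrazinInvertibleMod J a) (hb : IsDrazinInvertibleMod J b) (hab : Commute a b) :
    IsDrazinInvertibleMod J (a * b) := by
  obtain ⟨s, hs, -, ⟨n, hn⟩, hsJ⟩ := ha.exists_drazinInverse
  obtain ⟨t, ht, -, ⟨m, hm⟩, htJ⟩ := hb.exists_drazinInverse
  have hsa : Commute s a := hs a (Commute.refl a)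
  have hsb : Commute s b := hs b hab
  have hta : Commute t a := ht a hab.symm
  have htb : Commute t b := ht b (Commute.refl b)
  have hresidue : 1 - a * b * (s * t) = (1 - a * s) + (a * s) * (1 - b * t) := by
    rw [mul_assoc a b, ← mul_assoc b, ← hsb.eq]
    noncomm_ring
  refine ⟨s * t, (hsa.symm.mul_right hta.symm).mul_left (hsb.symm.mul_right htb.symm),
    ⟨max n m, ?_⟩, ?_⟩
  · have ha0 : (a * b) ^ max n m * (1 - a * s) = 0 := by
      rw [hab.mul_pow, (hab.pow_pow _ _).eq, mul_assoc,
        pow_mul_eq_zero_of_le hn (le_max_left n m), mul_zero]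
    have hb0 : (a * b) ^ max n m * (1 - b * t) = 0 := by
      rw [hab.mul_pow, mul_assoc, pow_mul_eq_zero_of_le hm (le_max_right n m), mul_zero]
    have hcomm : Commute ((a * b) ^ max n m) (a * s) :=
      (((Commute.refl a).mul_left hab.symm).mul_right (hsa.symm.mul_left hsb.symm)).pow_left _
    rw [hresidue, mul_add, ha0, zero_add, ← mul_assoc, hcomm.eq, mul_assoc, hb0, mul_zero]
  · rw [hresidue]
    exact J.add_mem hsJ (J.mul_mem_left _ _ htJ)

lemma of_pow {k : ℕ} (hk : k ≠ 0) (h : IsDrazinInvertibleMod J (a ^ k)) :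
    IsDrazinInvertibleMod J a := by
  obtain ⟨s, hs, -, ⟨n, hn⟩, hsJ⟩ := h.exists_drazinInverse
  have hpow : a * (a ^ (k - 1) * s) = a ^ k * s := by rw [← mul_assoc, mul_pow_sub_one hk]
  refine ⟨a ^ (k - 1) * s, ((Commute.refl a).pow_right _).mul_right
    (hs a (Commute.pow_self a k)).symm, ?_⟩
  rw [hpow]
  exact ⟨⟨k * n, by rw [pow_mul, hn]⟩, hsJ⟩

end IsDrazinInvertibleMod

lemma isDrazinInvertibleMod_bot_iff {a : R} :
    IsDrazinInvertibleMod (⊥ : TwoSidedIdeal R) a ↔ IsUnit a := by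
  constructor
  · rintro ⟨b, hab, -, h⟩
    have hone : a * b = 1 := (sub_eq_zero.1 ((TwoSidedIdeal.mem_bot R).1 h)).symm
    exact ⟨⟨a, b, hone, hab.eq ▸ hone⟩, rfl⟩
  · rintro ⟨u, rfl⟩
    refine ⟨↑u⁻¹, (Commute.refl (u : R)).units_inv_right, ?_⟩
    rw [u.mul_inv, sub_self]
    exact ⟨⟨0, mul_zero _⟩, TwoSidedIdeal.zero_mem _⟩

end Ring

section Polynomial

variable {𝕜 R : Type*} [Field 𝕜] [Ring R] [Algebra 𝕜 R] {J : TwoSidedIdeal R} {a : R}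

lemma commute_aeval_aeval (a : R) (p q : 𝕜[X]) : Commute (aeval a p) (aeval a q) := by
  rw [Commute, SemiconjBy, ← map_mul, ← map_mul, mul_comm]

namespace IsDrazinInvertibleMod

lemma of_isCoprime {p q : 𝕜[X]} (hpq : IsCoprime p q)
    (h : IsDrazinInvertibleMod J (aeval a (p * q))) : IsDrazinInvertibleMod J (aeval a p) := by
  obtain ⟨s, hs, -, ⟨n, hn⟩, hsJ⟩ := h.exists_drazinInverse
  obtain ⟨u, v, huv⟩ : IsCoprime (p ^ (n + 1)) (q ^ (n + 1)) := hpq.pow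
  have hcs (r : 𝕜[X]) : Commute (aeval a r) s := (hs _ (commute_aeval_aeval a _ r)).symm
  set e := 1 - aeval a (p * q) * s with he
  have hce (r : 𝕜[X]) : Commute (aeval a r) e :=
    (Commute.one_right _).sub_right ((commute_aeval_aeval a r _).mul_right (hcs r))
  -- `p` is inverted by `q * s` off the residue `e` and, up to `v * q ^ (n + 1)`, by `u * p ^ n`.
  have hresidue : 1 - aeval a p * (aeval a q * s + aeval a (u * p ^ n) * e)
      = aeval a (v * q ^ (n + 1)) * e := by
    have hone : aeval a p * (aeval a q * s) = 1 - e := by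
      rw [he, sub_sub_cancel, map_mul, mul_assoc]
    have hpn : aeval a p * (aeval a (u * p ^ n) * e) = aeval a (1 - v * q ^ (n + 1)) * e := by
      rw [← mul_assoc, ← map_mul, ← huv]
      congr 2
      ring
    rw [mul_add, hone, hpn, map_sub, map_one]
    noncomm_ring
  refine ⟨aeval a q * s + aeval a (u * p ^ n) * e,
    ((commute_aeval_aeval a _ _).mul_right (hcs p)).add_right
      ((commute_aeval_aeval a _ _).mul_right (hce p)), ?_⟩
  rw [hresidue]
  refine ⟨⟨n + 1, ?_⟩, J.mul_mem_left _ _ hsJ⟩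
  rw [← mul_assoc, ← map_pow, ← map_mul,
    show p ^ (n + 1) * (v * q ^ (n + 1)) = v * (p * q) ^ (n + 1) by ring, map_mul, map_pow,
    mul_assoc, pow_mul_eq_zero_of_le hn n.le_succ, mul_zero]

lemma of_isRoot {p : 𝕜[X]} (hp : p ≠ 0) (h : IsDrazinInvertibleMod J (aeval a p)) {z : 𝕜}
    (hz : p.IsRoot z) : IsDrazinInvertibleMod J (a - algebraMap 𝕜 R z) := by
  obtain ⟨q, hq, hndvd⟩ := exists_eq_pow_rootMultiplicity_mul_and_not_dvd p hp z
  have hcoprime : IsCoprime ((X - C z) ^ rootMultiplicity z p) q :=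
    (((prime_X_sub_C z).irreducible.coprime_iff_not_dvd).2 hndvd).pow_left
  rw [hq] at h
  have hpow := h.of_isCoprime hcoprime
  rw [map_pow] at hpow
  simpa only [map_sub, aeval_X, aeval_C] using hpow.of_pow ((rootMultiplicity_pos hp).2 hz).ne'

lemma aeval_multiset_prod {s : Multiset 𝕜}
    (h : ∀ z ∈ s, IsDrazinInvertibleMod J (a - algebraMap 𝕜 R z)) :
    IsDrazinInvertibleMod J (aeval a (s.map fun z => X - C z).prod) := by
  induction s using Multiset.induction_on with
  | empty =>
    rw [Multiset.map_zero, Multiset.prod_zero, map_one]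
    exact one
  | cons z s ih =>
    rw [Multiset.map_cons, Multiset.prod_cons, map_mul]
    refine mul ?_ (ih fun y hy => h y (Multiset.mem_cons_of_mem hy)) (commute_aeval_aeval a _ _)
    simpa only [map_sub, aeval_X, aeval_C] using h z (Multiset.mem_cons_self z s)

end IsDrazinInvertibleMod

lemma isDrazinInvertibleMod_aeval_iff [IsAlgClosed 𝕜] {p : 𝕜[X]} (hp : p.Monic) :
    IsDrazinInvertibleMod J (aeval a p) ↔
      ∀ z, p.IsRoot z → IsDrazinInvertibleMod J (a - algebraMap 𝕜 R z) := by
  refine ⟨fun h z hz => h.of_isRoot hp.ne_zero hz, fun h => ?_⟩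
  rw [(IsAlgClosed.splits p).eq_prod_roots_of_monic hp]
  exact .aeval_multiset_prod fun z hz => h z (isRoot_of_mem_roots hz)

lemma isDrazinInvertibleMod_pow_sub_iff [IsAlgClosed 𝕜] {m : ℕ} (hm : m ≠ 0) (w : 𝕜) :
    IsDrazinInvertibleMod J (a ^ m - algebraMap 𝕜 R w) ↔
      ∀ z, z ^ m = w → IsDrazinInvertibleMod J (a - algebraMap 𝕜 R z) := by
  simpa only [map_sub, map_pow, aeval_X, aeval_C, IsRoot.def, eval_sub, eval_pow, eval_X, eval_C,
    sub_eq_zero] using isDrazinInvertibleMod_aeval_iff (J := J) (a := a) (monic_X_pow_sub_C w hm)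

end Polynomial

section IsolatedPoints

variable {𝕜 R : Type*} [NontriviallyNormedField 𝕜] [NormedRing R] [NormedAlgebra 𝕜 R]
  [CompleteSpace R] {J : TwoSidedIdeal R} {a : R}

lemma eventually_isUnit_sub_algebraMap (h : IsUnit a) :
    ∀ᶠ z in 𝓝 (0 : 𝕜), IsUnit (a - algebraMap 𝕜 R z) := by
  have hcont : Continuous fun z : 𝕜 => a - algebraMap 𝕜 R z :=
    continuous_const.sub (continuous_algebraMap 𝕜 R)
  refine hcont.continuousAt.preimage_mem_nhds (Units.isOpen.mem_nhds ?_)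
  rwa [map_zero, sub_zero]

lemma IsDrazinInvertibleMod.eventually_isUnit (h : IsDrazinInvertibleMod J a) :
    ∀ᶠ z in 𝓝[≠] (0 : 𝕜), IsUnit (a - algebraMap 𝕜 R z) := by
  obtain ⟨e, -, he, hcomm, ⟨n, hn⟩, hu⟩ := h.exists_idempotent
  have hae : Commute a e := (hcomm a (Commute.refl a)).symm
  filter_upwards [nhdsWithin_le_nhds (eventually_isUnit_sub_algebraMap hu), self_mem_nhdsWithin]
    with z hunit hz
  have hze (x : R) : Commute (algebraMap 𝕜 R z) x := Algebra.commutes z x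
  have hnil : IsUnit (a * e - algebraMap 𝕜 R z) := by
    have hpow : (a * e) ^ (n + 1) = 0 := by
      rw [hae.mul_pow, he.pow_succ_eq, pow_mul_eq_zero_of_le hn n.le_succ]
    rw [sub_eq_add_neg]
    exact IsNilpotent.isUnit_add_right_of_commute ⟨n + 1, hpow⟩
      (((IsUnit.mk0 z hz).map (algebraMap 𝕜 R)).neg) ((hze (a * e)).symm.neg_right)
  have hglue : a - algebraMap 𝕜 R z
      = peirceGlue e (peirceGlue e a 1 - algebraMap 𝕜 R z) (a * e - algebraMap 𝕜 R z) := by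
    simp only [peirceGlue, sub_mul, add_mul, mul_assoc, he.one_sub.eq, he.mul_one_sub_self, he.eq]
    noncomm_ring
  rw [hglue]
  refine isUnit_peirceGlue he (Commute.sub_left ?_ (hze e)) (Commute.sub_left ?_ (hze e))
    hunit hnil
  · exact (commute_peirceGlue (Commute.refl e) hae.symm (Commute.one_right e)).symm
  · exact hae.mul_left (Commute.refl e)

lemma IsDrazinInvertibleMod.eventually_notMem_spectrum (h : IsDrazinInvertibleMod J a) :
    ∀ᶠ z in 𝓝[≠] (0 : 𝕜), z ∉ spectrum 𝕜 a := by
  filter_upwards [h.eventually_isUnit] with z hz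
  rwa [spectrum.notMem_iff, IsUnit.sub_iff]

end IsolatedPoints

section OneSubPow

variable {R : Type*} [Ring R]

lemma inverse_one_sub_sq_eq_mul {x : R} (hx : IsUnit (1 - x)) :
    Ring.inverse (1 - x ^ 2) = Ring.inverse (1 + x) * Ring.inverse (1 - x) := by
  rw [← Ring.inverse_mul (Or.inl hx), sq]
  congr 1
  noncomm_ring

lemma pow_mul_inverse_one_sub_pow {x : R} {n : ℕ} (hx : IsUnit (1 - x ^ n)) :
    x ^ n * Ring.inverse (1 - x ^ n) = Ring.inverse (1 - x ^ n) - 1 := by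
  have h := Ring.mul_inverse_cancel _ hx
  rw [sub_mul, one_mul] at h
  exact eq_sub_of_add_eq' (sub_eq_iff_eq_add.1 h).symm

lemma commute_inverse_one_sub_pow {x e : R} {n : ℕ} (hx : IsUnit (1 - x ^ n))
    (hxe : Commute x e) : Commute (Ring.inverse (1 - x ^ n)) e := by
  have h : Commute (1 - x ^ n) e := (Commute.one_left e).sub_left (hxe.pow_left n)
  obtain ⟨u, hu⟩ := hx
  rw [← hu] at h ⊢
  rw [Ring.inverse_unit]
  exact h.units_inv_left

end OneSubPow

section InverseLimit

variable {R : Type*} [NormedRing R]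

lemma tendsto_peirceGlue {e x y : R} {f g : ℕ → R} (hf : Tendsto f atTop (𝓝 x))
    (hg : Tendsto g atTop (𝓝 y)) :
    Tendsto (fun k => peirceGlue e (f k) (g k)) atTop (𝓝 (peirceGlue e x y)) :=
  (hf.mul_const _).add (hg.mul_const _)

variable [CompleteSpace R]

lemma tendsto_pow_two_pow_mul_of_tendsto_inverse {b e : R} (he : IsIdempotentElem e)
    (hbe : Commute b e) (hunit : ∀ k, IsUnit (1 - b ^ 2 ^ k))
    (hlim : Tendsto (fun k => Ring.inverse (1 - b ^ 2 ^ k)) atTop (𝓝 e)) :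
    Tendsto (fun k => (b * e) ^ 2 ^ k) atTop (𝓝 0) := by
  set E := fun k => Ring.inverse (1 - b ^ 2 ^ k)
  have hglue : Tendsto (fun k => peirceGlue e 1 (E k)) atTop (𝓝 1) := by
    convert tendsto_peirceGlue (e := e) tendsto_const_nhds hlim
    rw [peirceGlue, one_mul, he.eq, sub_add_cancel]
  have hinv : Tendsto (fun k => Ring.inverse (peirceGlue e 1 (E k))) atTop (𝓝 1) := by
    have h := (NormedRing.inverse_continuousAt (1 : Rˣ)).tendsto
    rw [Units.val_one, Ring.inverse_one] at h
    exact h.comp hglue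
  have hzero : Tendsto (fun k => peirceGlue e 0 (E k - 1)) atTop (𝓝 0) := by
    convert tendsto_peirceGlue (e := e) tendsto_const_nhds (hlim.sub_const 1)
    rw [peirceGlue, zero_mul, zero_add, sub_mul, he.eq, one_mul, sub_self]
  have hprod := hzero.mul hinv
  rw [zero_mul] at hprod
  refine hprod.congr' ?_
  filter_upwards [hglue.eventually (Units.isOpen.mem_nhds isUnit_one)] with k hk
  have hpow : (b * e) ^ 2 ^ k = peirceGlue e 0 (b ^ 2 ^ k) := by
    rw [hbe.mul_pow, he.pow_eq (pow_ne_zero k two_ne_zero), peirceGlue, zero_mul, zero_add]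
  have hfactor : peirceGlue e 0 (E k - 1) = (b * e) ^ 2 ^ k * peirceGlue e 1 (E k) := by
    rw [hpow, peirceGlue_mul he (Commute.one_left e) (commute_inverse_one_sub_pow (hunit k) hbe),
      zero_mul, pow_mul_inverse_one_sub_pow (hunit k)]
  rw [hfactor, mul_assoc, Ring.mul_inverse_cancel _ hk, mul_one]

lemma isUnit_peirceGlue_of_tendsto_inverse {b e : R} (he : IsIdempotentElem e) (hbe : Commute b e)
    (hunit : ∀ k, IsUnit (1 - b ^ 2 ^ k))
    (hlim : Tendsto (fun k => Ring.inverse (1 - b ^ 2 ^ k)) atTop (𝓝 e)) :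
    IsUnit (peirceGlue e b 1) := by
  set E := fun k => Ring.inverse (1 - b ^ 2 ^ k)
  have hglue : Tendsto (fun k => peirceGlue e (E k - 1) 1) atTop (𝓝 (peirceGlue e (-1) 1)) := by
    convert tendsto_peirceGlue (e := e) (hlim.sub_const 1) tendsto_const_nhds using 2
    rw [peirceGlue, peirceGlue, sub_mul, he.mul_one_sub_self, zero_sub, neg_mul]
  have hlimUnit : IsUnit (peirceGlue e (-1) 1) :=
    isUnit_peirceGlue he (Commute.neg_one_left e) (Commute.one_left e) isUnit_one.neg isUnit_one
  obtain ⟨k, hk⟩ := (hglue.eventually (Units.isOpen.mem_nhds hlimUnit)).exists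
  have hEe : Commute (E k) e := commute_inverse_one_sub_pow (hunit k) hbe
  have hfactor : peirceGlue e (E k - 1) 1 = peirceGlue e b 1 ^ 2 ^ k * peirceGlue e (E k) 1 := by
    rw [peirceGlue_pow he hbe (Commute.one_left e), peirceGlue_mul he hEe (Commute.one_left e),
      pow_mul_inverse_one_sub_pow (hunit k), one_pow, one_mul]
  rw [hfactor, Commute.isUnit_mul_iff, isUnit_pow_iff (pow_ne_zero k two_ne_zero)] at hk
  · exact hk.1
  · have hEb : Commute (E k) b := commute_inverse_one_sub_pow (hunit k) (Commute.refl b)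
    have hglueE : Commute e (peirceGlue e (E k) 1) :=
      commute_peirceGlue (Commute.refl e) hEe.symm (Commute.one_right e)
    have hglueb : Commute b (peirceGlue e (E k) 1) :=
      commute_peirceGlue hbe hEb.symm (Commute.one_right b)
    exact ((commute_peirceGlue hglueE.symm hglueb.symm (Commute.one_right _)).pow_right _).symm

end InverseLimit

section RieszIdempotent

variable {A : Type*} [NormedRing A] [NormedAlgebra ℂ A]

lemma spectrum_mul_idempotent_subset {a e : A} (he : IsIdempotentElem e) (hae : Commute a e) :
    spectrum ℂ (a * e) ⊆ insert 0 (spectrum ℂ a) := by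
  intro z hz
  by_contra h
  obtain ⟨hz0, hza⟩ := not_or.1 h
  have hze : Commute (algebraMap ℂ A z) e := Algebra.commutes z e
  have hunit := isUnit_peirceGlue he hze (hze.sub_left hae) ((IsUnit.mk0 z hz0).map _)
    (spectrum.notMem_iff.1 hza)
  refine spectrum.mem_iff.1 hz ?_
  convert hunit using 1
  rw [peirceGlue]
  noncomm_ring

lemma norm_lt_one_of_tendsto_pow_two_pow {c : A} [CompleteSpace A]
    (hc : Tendsto (fun k => c ^ 2 ^ k) atTop (𝓝 0)) {z : ℂ} (hz : z ∈ spectrum ℂ c) : ‖z‖ < 1 := by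
  have hlim : Tendsto (fun k => ‖c ^ 2 ^ k‖ * ‖(1 : A)‖) atTop (𝓝 0) := by
    simpa only [norm_zero, zero_mul] using hc.norm.mul_const ‖(1 : A)‖
  obtain ⟨k, hk⟩ := (hlim.eventually_lt_const one_pos).exists
  have hzk := spectrum.norm_le_norm_mul_of_mem (spectrum.pow_mem_pow c (2 ^ k) hz)
  rw [norm_pow] at hzk
  exact (pow_lt_one_iff_of_nonneg (norm_nonneg z) (pow_ne_zero k two_ne_zero)).1 (hzk.trans_lt hk)

lemma inverse_one_sub_sq_eq_midpoint {x : A} (hx : IsUnit (1 - x)) (hx' : IsUnit (1 + x)) :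
    Ring.inverse (1 - x ^ 2) = midpoint ℂ (Ring.inverse (1 - x)) (Ring.inverse (1 + x)) := by
  rw [inverse_one_sub_sq_eq_mul hx]
  obtain ⟨p, hp⟩ := hx
  obtain ⟨q, hq⟩ := hx'
  rw [← hp, ← hq, Ring.inverse_unit, Ring.inverse_unit]
  have hsum : (p : A) + q = (2 : ℂ) • 1 := by
    rw [hp, hq, two_smul]
    abel
  have hinv : (↑p⁻¹ : A) + ↑q⁻¹ = (2 : ℂ) • (↑q⁻¹ * ↑p⁻¹) := by
    calc (↑p⁻¹ : A) + ↑q⁻¹ = ↑q⁻¹ * (p + q) * ↑p⁻¹ := by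
          rw [mul_add, add_mul, mul_assoc, p.mul_inv, q.inv_mul, mul_one, one_mul, add_comm]
      _ = (2 : ℂ) • (↑q⁻¹ * ↑p⁻¹) := by
          rw [hsum, mul_smul_comm, mul_one, smul_mul_assoc]
  rw [midpoint_eq_smul_add, hinv, smul_smul, invOf_mul_self, one_smul]

/-- The value at `z` on the unit circle of the resolvent type function `(1 - (z b)^(2^k))⁻¹`. As
`k → ∞` it tends to the Riesz idempotent of `b` for the part of the spectrum inside the circle,
which replaces the contour integral. -/
noncomputable def powResolvent (b : A) (k : ℕ) (z : Circle) : A :=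
  Ring.inverse (1 - (z • b) ^ 2 ^ k)

/-- A primitive `2 ^ (k + 1)`-th root of unity, chosen close to `1`. -/
noncomputable def halfTurnRoot (k : ℕ) : Circle :=
  Circle.exp (Real.pi / 2 ^ k)

lemma halfTurnRoot_pow (k : ℕ) : halfTurnRoot k ^ 2 ^ k = -1 := by
  rw [halfTurnRoot, ← Circle.exp_natCast_mul]
  ext
  push_cast
  rw [mul_div_cancel₀ _ (pow_ne_zero k two_ne_zero), Complex.exp_pi_mul_I]

lemma dist_halfTurnRoot_one_le (k : ℕ) : dist (halfTurnRoot k) 1 ≤ Real.pi / 2 ^ k := by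
  have h := Real.norm_exp_I_mul_ofReal_sub_one_le (x := Real.pi / 2 ^ k)
  rw [Real.norm_of_nonneg (by positivity), mul_comm] at h
  exact (dist_eq_norm (halfTurnRoot k : ℂ) 1).trans_le h

lemma dist_mul_right_circle (z y w : Circle) : dist (z * w) (y * w) = dist z y := by
  change dist ((z : ℂ) * w) (y * w) = dist (z : ℂ) y
  rw [dist_eq_norm, ← sub_mul, norm_mul, Circle.norm_coe, mul_one, dist_eq_norm]

lemma mul_halfTurnRoot_smul_pow (b : A) (k : ℕ) (z : Circle) :
    ((z * halfTurnRoot k) • b) ^ 2 ^ k = -(z • b) ^ 2 ^ k := by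
  rw [_root_.smul_pow, _root_.smul_pow, mul_pow, halfTurnRoot_pow, mul_neg_one, Circle.smul_def,
    Circle.smul_def, Circle.coe_neg, neg_smul]

variable {b : A} (hb : ∀ z : Circle, IsUnit (1 - z • b))

include hb in
lemma isUnit_one_sub_smul_pow (k : ℕ) (z : Circle) : IsUnit (1 - (z • b) ^ 2 ^ k) := by
  induction k generalizing z with
  | zero => simpa only [pow_zero, pow_one] using hb z
  | succ k ih =>
    have hrot := ih (z * halfTurnRoot k)
    rw [mul_halfTurnRoot_smul_pow, sub_neg_eq_add] at hrot
    convert (ih z).mul hrot using 1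
    rw [pow_succ 2 k, pow_mul]
    noncomm_ring

include hb in
lemma powResolvent_succ_eq_mul (k : ℕ) (z : Circle) :
    powResolvent b (k + 1) z = powResolvent b k (z * halfTurnRoot k) * powResolvent b k z := by
  simp only [powResolvent, mul_halfTurnRoot_smul_pow, sub_neg_eq_add, pow_succ 2 k, pow_mul]
  exact inverse_one_sub_sq_eq_mul (isUnit_one_sub_smul_pow hb k z)

include hb in
lemma powResolvent_succ_eq_midpoint (k : ℕ) (z : Circle) :
    powResolvent b (k + 1) z =
      midpoint ℂ (powResolvent b k z) (powResolvent b k (z * halfTurnRoot k)) := by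
  have hrot := isUnit_one_sub_smul_pow hb k (z * halfTurnRoot k)
  rw [mul_halfTurnRoot_smul_pow, sub_neg_eq_add] at hrot
  simp only [powResolvent, mul_halfTurnRoot_smul_pow, sub_neg_eq_add, pow_succ 2 k, pow_mul]
  exact inverse_one_sub_sq_eq_midpoint (isUnit_one_sub_smul_pow hb k z) hrot

variable [CompleteSpace A]

include hb in
lemma exists_lipschitzWith_inverse_one_sub_smul :
    ∃ K, LipschitzWith K fun z : Circle => Ring.inverse (1 - z • b) := by
  have hcont : Continuous fun z : Circle => Ring.inverse (1 - z • b) := by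
    refine continuous_iff_continuousAt.2 fun z => ?_
    obtain ⟨u, hu⟩ := hb z
    exact ContinuousAt.comp (g := Ring.inverse) (f := fun z : Circle => 1 - z • b)
      (hu ▸ NormedRing.inverse_continuousAt u) (by fun_prop)
  obtain ⟨C, hC⟩ := isCompact_univ.exists_bound_of_continuousOn hcont.continuousOn
  have hC0 : 0 ≤ C := (norm_nonneg _).trans (hC 1 (mem_univ 1))
  refine ⟨(C * ‖b‖ * C).toNNReal, LipschitzWith.of_dist_le' fun z y => ?_⟩
  have hdiff : Ring.inverse (1 - z • b) - Ring.inverse (1 - y • b) =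
      (z - y : ℂ) • (Ring.inverse (1 - z • b) * b * Ring.inverse (1 - y • b)) := by
    obtain ⟨p, hp⟩ := hb z
    obtain ⟨q, hq⟩ := hb y
    rw [← hp, ← hq, Ring.inverse_unit, Ring.inverse_unit]
    have hzy : (z - y : ℂ) • b = q - p := by
      rw [hp, hq, sub_smul, Circle.smul_def, Circle.smul_def]
      abel
    rw [← smul_mul_assoc, ← mul_smul_comm, hzy, mul_sub, sub_mul, p.inv_mul, mul_assoc,
      q.mul_inv, mul_one, one_mul]
  rw [dist_eq_norm, hdiff, norm_smul, mul_comm, ← dist_eq_norm (z : ℂ)]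
  refine mul_le_mul_of_nonneg_right ?_ dist_nonneg
  grw [norm_mul_le, norm_mul_le, hC z (mem_univ z), hC y (mem_univ y)]

include hb in
lemma exists_lipschitzWith_powResolvent : ∃ K, ∀ k, LipschitzWith K (powResolvent b k) := by
  obtain ⟨K, hK⟩ := exists_lipschitzWith_inverse_one_sub_smul hb
  refine ⟨K, fun k => ?_⟩
  induction k with
  | zero =>
    convert hK using 1
    ext z
    rw [powResolvent, pow_zero, pow_one]
  | succ k ih =>
    refine LipschitzWith.of_dist_le_mul fun z y => ?_
    have hrot := ih.dist_le_mul (z * halfTurnRoot k) (y * halfTurnRoot k)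
    rw [dist_mul_right_circle] at hrot
    rw [powResolvent_succ_eq_midpoint hb, powResolvent_succ_eq_midpoint hb]
    grw [dist_midpoint_midpoint_le', hrot, ih.dist_le_mul z y, RCLike.norm_ofNat, add_self_div_two]

include hb in
lemma exists_dist_powResolvent_halfTurnRoot_le :
    ∃ C, ∀ k, dist (powResolvent b k 1) (powResolvent b k (1 * halfTurnRoot k)) ≤ C / 2 ^ k := by
  obtain ⟨K, hK⟩ := exists_lipschitzWith_powResolvent hb
  refine ⟨K * Real.pi, fun k => ?_⟩
  grw [(hK k).dist_le_mul, one_mul, dist_comm, dist_halfTurnRoot_one_le, mul_div_assoc]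

include hb in
lemma exists_tendsto_powResolvent :
    ∃ e : A, IsIdempotentElem e ∧ Tendsto (fun k => powResolvent b k 1) atTop (𝓝 e) := by
  obtain ⟨C, hC⟩ := exists_dist_powResolvent_halfTurnRoot_le hb
  have hcauchy : CauchySeq fun k => powResolvent b k 1 := by
    refine cauchySeq_of_le_geometric_two (C := C) fun k => ?_
    rw [powResolvent_succ_eq_midpoint hb, dist_left_midpoint, RCLike.norm_ofNat]
    grw [hC k]
    exact le_of_eq (by ring)
  obtain ⟨e, he⟩ := cauchySeq_tendsto_of_complete hcauchy
  have hrot : Tendsto (fun k => powResolvent b k (1 * halfTurnRoot k)) atTop (𝓝 e) := by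
    refine he.congr_dist (squeeze_zero (fun _ => dist_nonneg) hC ?_)
    simpa only [mul_zero, div_eq_mul_inv, inv_pow] using (tendsto_pow_atTop_nhds_zero_of_lt_one
      (r := (2⁻¹ : ℝ)) (by norm_num) (by norm_num)).const_mul C
  refine ⟨e, tendsto_nhds_unique (hrot.mul he) ?_, he⟩
  exact ((tendsto_add_atTop_iff_nat 1).2 he).congr fun k => powResolvent_succ_eq_mul hb k 1

lemma exists_idempotent_of_norm_ne_one (hb : ∀ z ∈ spectrum ℂ b, ‖z‖ ≠ 1) :
    ∃ e : A, IsIdempotentElem e ∧ Commute b e ∧ IsUnit (peirceGlue e b 1) ∧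
      spectrum ℂ (b * e) ⊆ Metric.ball 0 1 := by
  have hcircle : ∀ z : Circle, IsUnit (1 - z • b) := by
    intro z
    rw [← inv_inv z, ← IsUnit.smul_sub_iff_sub_inv_smul, Circle.smul_def,
      ← Algebra.algebraMap_eq_smul_one]
    exact spectrum.notMem_iff.1 fun hz => hb _ hz (Circle.norm_coe _)
  obtain ⟨e, he, hlim⟩ := exists_tendsto_powResolvent hcircle
  simp only [powResolvent, one_smul] at hlim
  have hunit : ∀ k, IsUnit (1 - b ^ 2 ^ k) := fun k => by
    simpa only [one_smul] using isUnit_one_sub_smul_pow hcircle k 1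
  have hbe : Commute b e := tendsto_nhds_unique (hlim.const_mul b)
    ((hlim.mul_const b).congr fun k => commute_inverse_one_sub_pow (hunit k) (Commute.refl b))
  exact ⟨e, he, hbe, isUnit_peirceGlue_of_tendsto_inverse he hbe hunit hlim, fun z hz =>
    mem_ball_zero_iff.2 (norm_lt_one_of_tendsto_pow_two_pow
      (tendsto_pow_two_pow_mul_of_tendsto_inverse he hbe hunit hlim) hz)⟩

lemma exists_idempotent_of_norm_ne {a : A} {r : ℝ} (hr : 0 < r)
    (ha : ∀ z ∈ spectrum ℂ a, ‖z‖ ≠ r) :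
    ∃ e : A, IsIdempotentElem e ∧ Commute a e ∧ IsUnit (peirceGlue e a 1) ∧
      spectrum ℂ (a * e) ⊆ Metric.ball 0 r := by
  let ρ : ℂˣ := Units.mk0 (r : ℂ) (Complex.ofReal_ne_zero.2 hr.ne')
  have hρ : ‖(ρ : ℂ)‖ = r := Complex.norm_of_nonneg hr.le
  obtain ⟨e, he, hcomm, hunit, hspec⟩ := exists_idempotent_of_norm_ne_one (b := ρ⁻¹ • a)
    fun z hz h1 => ha (ρ • z) (by
      rw [spectrum.unit_smul_eq_smul] at hz
      simpa only [mem_inv_smul_set_iff] using hz) (by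
        rw [Units.smul_def, norm_smul, hρ, h1, mul_one])
  have hae : Commute a e := by
    simpa only [smul_inv_smul] using hcomm.smul_left ρ
  refine ⟨e, he, hae, ?_, fun z hz => ?_⟩
  · have hfactor :
        peirceGlue e a 1 = peirceGlue e (algebraMap ℂ A ρ) 1 * peirceGlue e (ρ⁻¹ • a) 1 := by
      rw [peirceGlue_mul he hcomm (Commute.one_left e), one_mul, ← Algebra.smul_def,
        ← Units.smul_def, smul_inv_smul]
    rw [hfactor]
    exact (isUnit_peirceGlue he (Algebra.commutes _ e) (Commute.one_left e)
      (ρ.isUnit.map (algebraMap ℂ A)) isUnit_one).mul hunit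
  · have hz' := hspec (a := ρ⁻¹ • z) (by
      rwa [smul_mul_assoc, spectrum.unit_smul_eq_smul, smul_mem_smul_set_iff])
    rwa [mem_ball_zero_iff, Units.smul_def, norm_smul, Units.val_inv_eq_inv_val, norm_inv, hρ,
      inv_mul_lt_one₀ hr, ← mem_ball_zero_iff] at hz'

end RieszIdempotent

section IsolatedSpectralPart

lemma exists_norm_ne_of_countable {E : Type*} [Norm E] {C : Set E} (hC : C.Countable) {ρ : ℝ}
    (hρ : 0 < ρ) : ∃ r ∈ Ioo 0 ρ, ∀ z ∈ C, ‖z‖ ≠ r := by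
  obtain ⟨r, hr, hrC⟩ := ((hC.image norm).dense_compl ℝ).inter_open_nonempty _
    isOpen_Ioo (nonempty_Ioo.2 hρ)
  exact ⟨r, hr, fun z hz h => hrC ⟨z, hz, h⟩⟩

lemma exists_idempotent_of_zero_notMem_derivedSet {R : Type*} [NormedRing R] [NormedAlgebra ℂ R]
    [CompleteSpace R] {a : R} {A : Set ℂ} (hA : 0 ∉ derivedSet A)
    (hcount : (spectrum ℂ a \ A).Countable) :
    ∃ e, IsIdempotentElem e ∧ Commute a e ∧ IsUnit (peirceGlue e a 1) ∧
      spectrum ℂ (a * e) ∩ A ⊆ {0} := by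
  rw [mem_derivedSet, accPt_iff_frequently_nhdsNE, not_frequently, eventually_nhdsWithin_iff,
    Metric.eventually_nhds_iff] at hA
  obtain ⟨ρ, hρ, hball⟩ := hA
  have hzero {z : ℂ} (hz : z ∈ A) (hzρ : ‖z‖ < ρ) : z = 0 := by
    by_contra hz0
    exact hball (by rwa [dist_zero_right]) hz0 hz
  obtain ⟨r, ⟨hr, hrρ⟩, hrC⟩ := exists_norm_ne_of_countable hcount hρ
  have hcircle (z : ℂ) (hz : z ∈ spectrum ℂ a) : ‖z‖ ≠ r := by
    by_cases hzA : z ∈ A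
    · rintro rfl
      exact hr.ne' (norm_eq_zero.2 (hzero hzA hrρ))
    · exact hrC z ⟨hz, hzA⟩
  obtain ⟨e, he, hae, hu, hsp⟩ := exists_idempotent_of_norm_ne hr hcircle
  exact ⟨e, he, hae, hu, fun z hz =>
    hzero hz.2 ((mem_ball_zero_iff.1 (hsp hz.1)).trans hrρ)⟩

end IsolatedSpectralPart

section Residue

variable {X : Type u} [NormedAddCommGroup X] [NormedSpace ℂ X]
variable {Y : Type v} [NormedAddCommGroup Y] [NormedSpace ℂ Y]

/-- The two-sided ideal of the bounded operators of finite rank. -/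
def finiteRankIdeal (X : Type u) [NormedAddCommGroup X] [NormedSpace ℂ X] :
    TwoSidedIdeal (X →L[ℂ] X) :=
  TwoSidedIdeal.mk' {x | x.toLinearMap.HasFiniteRange} LinearMap.HasFiniteRange.zero
    (fun hx hy => LinearMap.HasFiniteRange.add hx hy) (fun hx => LinearMap.HasFiniteRange.neg hx)
    (fun hy => LinearMap.HasFiniteRange.comp_left hy _)
    (fun hx => LinearMap.HasFiniteRange.comp_right hx _)

lemma mem_finiteRankIdeal {x : X →L[ℂ] X} :
    x ∈ finiteRankIdeal X ↔ x.toLinearMap.HasFiniteRange :=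
  TwoSidedIdeal.mem_mk' ..

/-- The ideal modulo which `T - z` is Drazin invertible exactly when `z ∉ σ_*(T)`; the idempotents
in it are those which may occur as spectral idempotents at points outside `σ_*(T)`. -/
def residueIdeal (s : SpectrumKind) (X : Type u) [NormedAddCommGroup X] [NormedSpace ℂ X] :
    TwoSidedIdeal (X →L[ℂ] X) :=
  match s with
  | .full => ⊥
  | .browder => finiteRankIdeal X
  | .drazin => ⊤

lemma comp_comp_mem_residueIdeal {s : SpectrumKind} {x : X →L[ℂ] X} (hx : x ∈ residueIdeal s X)
    (P : X →L[ℂ] Y) (Q : Y →L[ℂ] X) : P ∘L x ∘L Q ∈ residueIdeal s Y := by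
  cases s with
  | full =>
    rw [(TwoSidedIdeal.mem_bot _).1 hx, ContinuousLinearMap.zero_comp,
      ContinuousLinearMap.comp_zero]
    exact TwoSidedIdeal.zero_mem _
  | browder =>
    exact mem_finiteRankIdeal.2 (((mem_finiteRankIdeal.1 hx).comp_right _).comp_left _)
  | drazin => trivial

lemma comp_pow_of_comp_eq {T : X →L[ℂ] X} {S : Y →L[ℂ] Y} {P : X →L[ℂ] Y}
    (h : P ∘L T = S ∘L P) (k : ℕ) : P ∘L (T ^ k) = (S ^ k) ∘L P := by
  induction k with
  | zero => rfl
  | succ k ih =>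
    rw [pow_succ', pow_succ', ContinuousLinearMap.mul_def, ContinuousLinearMap.mul_def,
      ← ContinuousLinearMap.comp_assoc, h, ContinuousLinearMap.comp_assoc, ih,
      ContinuousLinearMap.comp_assoc]

lemma IsDrazinInvertibleMod.of_retract {s : SpectrumKind} {T : X →L[ℂ] X} {S : Y →L[ℂ] Y}
    (h : IsDrazinInvertibleMod (residueIdeal s X) T) (P : X →L[ℂ] Y) (Q : Y →L[ℂ] X)
    (hPQ : P ∘L Q = 1) (hP : P ∘L T = S ∘L P) (hQ : T ∘L Q = Q ∘L S) :
    IsDrazinInvertibleMod (residueIdeal s Y) S := by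
  obtain ⟨U, hTU, ⟨n, hn⟩, hJ⟩ := h
  have hleft : S * (P ∘L U ∘L Q) = P ∘L (T * U) ∘L Q :=
    calc S * (P ∘L U ∘L Q) = (S ∘L P) ∘L U ∘L Q := rfl
      _ = P ∘L (T * U) ∘L Q := by rw [← hP]; rfl
  have hright : (P ∘L U ∘L Q) * S = P ∘L (T * U) ∘L Q :=
    calc (P ∘L U ∘L Q) * S = P ∘L U ∘L Q ∘L S := rfl
      _ = P ∘L (T * U) ∘L Q := by rw [← hQ, hTU.eq]; rfl
  have hresidue : 1 - S * (P ∘L U ∘L Q) = P ∘L (1 - T * U) ∘L Q := by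
    rw [hleft, ContinuousLinearMap.sub_comp, ContinuousLinearMap.comp_sub, ← hPQ]
    rfl
  refine ⟨P ∘L U ∘L Q, hleft.trans hright.symm, ⟨n, ?_⟩, ?_⟩
  · calc S ^ n * (1 - S * (P ∘L U ∘L Q)) = ((S ^ n) ∘L P) ∘L (1 - T * U) ∘L Q := by
          rw [hresidue]; rfl
      _ = P ∘L (T ^ n * (1 - T * U)) ∘L Q := by rw [← comp_pow_of_comp_eq hP]; rfl
      _ = 0 := by rw [hn, ContinuousLinearMap.zero_comp, ContinuousLinearMap.comp_zero]
  · rw [hresidue]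
    exact comp_comp_mem_residueIdeal hJ P Q

lemma prodMap_mul_prodMap (S S' : Y →L[ℂ] Y) (T T' : X →L[ℂ] X) :
    S.prodMap T * S'.prodMap T' = (S * S').prodMap (T * T') :=
  rfl

lemma prodMap_pow (S : Y →L[ℂ] Y) (T : X →L[ℂ] X) (k : ℕ) :
    S.prodMap T ^ k = (S ^ k).prodMap (T ^ k) := by
  induction k with
  | zero => rfl
  | succ k ih => rw [pow_succ, ih, prodMap_mul_prodMap, pow_succ, pow_succ]

lemma prodMap_mem_residueIdeal {s : SpectrumKind} {S : Y →L[ℂ] Y} {T : X →L[ℂ] X}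
    (hS : S ∈ residueIdeal s Y) (hT : T ∈ residueIdeal s X) :
    S.prodMap T ∈ residueIdeal s (Y × X) := by
  have hsum : S.prodMap T = .inl ℂ Y X ∘L S ∘L .fst ℂ Y X + .inr ℂ Y X ∘L T ∘L .snd ℂ Y X := by
    ext <;> simp
  rw [hsum]
  exact (residueIdeal s _).add_mem (comp_comp_mem_residueIdeal hS _ _)
    (comp_comp_mem_residueIdeal hT _ _)

lemma IsDrazinInvertibleMod.prodMap {s : SpectrumKind} {S : Y →L[ℂ] Y} {T : X →L[ℂ] X}
    (hS : IsDrazinInvertibleMod (residueIdeal s Y) S)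
    (hT : IsDrazinInvertibleMod (residueIdeal s X) T) :
    IsDrazinInvertibleMod (residueIdeal s (Y × X)) (S.prodMap T) := by
  obtain ⟨U, hSU, ⟨n, hn⟩, hUJ⟩ := hS
  obtain ⟨V, hTV, ⟨m, hm⟩, hVJ⟩ := hT
  have hresidue : 1 - S.prodMap T * U.prodMap V = (1 - S * U).prodMap (1 - T * V) := by
    ext <;> simp
  refine ⟨U.prodMap V, ?_, ⟨max n m, ?_⟩, ?_⟩
  · rw [Commute, SemiconjBy, prodMap_mul_prodMap, prodMap_mul_prodMap, hSU.eq, hTV.eq]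
  · rw [hresidue, prodMap_pow, prodMap_mul_prodMap, pow_mul_eq_zero_of_le hn (le_max_left n m),
      pow_mul_eq_zero_of_le hm (le_max_right n m)]
    rfl
  · rw [hresidue]
    exact prodMap_mem_residueIdeal hUJ hVJ

lemma isDrazinInvertibleMod_prodMap_iff {s : SpectrumKind} {S : Y →L[ℂ] Y} {T : X →L[ℂ] X} :
    IsDrazinInvertibleMod (residueIdeal s (Y × X)) (S.prodMap T) ↔
      IsDrazinInvertibleMod (residueIdeal s Y) S ∧ IsDrazinInvertibleMod (residueIdeal s X) T :=
  ⟨fun h => ⟨h.of_retract (.fst ℂ Y X) (.inl ℂ Y X) rfl rfl (by ext <;> simp),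
    h.of_retract (.snd ℂ Y X) (.inr ℂ Y X) rfl rfl (by ext <;> simp)⟩,
    fun h => h.1.prodMap h.2⟩

end Residue

section FittingDecomposition

variable {R V : Type*} [Ring R] [AddCommGroup V] [Module R V] {f : Module.End R V}

lemma ker_pow_eq_of_le {n k : ℕ} (h : (f ^ n).ker = (f ^ (n + 1)).ker) (hk : n ≤ k) :
    (f ^ k).ker = (f ^ n).ker := by
  induction k, hk using Nat.le_induction with
  | base => rfl
  | succ k _ ih =>
    rw [pow_succ, Module.End.mul_eq_comp, LinearMap.ker_comp, ih, ← LinearMap.ker_comp,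
      ← Module.End.mul_eq_comp, ← pow_succ, h]

lemma range_pow_eq_of_le {n k : ℕ} (h : (f ^ n).range = (f ^ (n + 1)).range) (hk : n ≤ k) :
    (f ^ k).range = (f ^ n).range := by
  induction k, hk using Nat.le_induction with
  | base => rfl
  | succ k _ ih =>
    rw [pow_succ', Module.End.mul_eq_comp, LinearMap.range_comp, ih, ← LinearMap.range_comp,
      ← Module.End.mul_eq_comp, ← pow_succ', h]

lemma isCompl_ker_range (hker : (f * f).ker ≤ f.ker) (hrange : f.range ≤ (f * f).range) :
    IsCompl f.ker f.range := by
  refine IsCompl.of_eq ((Submodule.eq_bot_iff _).2 ?_) ((Submodule.eq_top_iff').2 fun x => ?_)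
  · rintro _ ⟨hx, w, rfl⟩
    exact hker hx
  · obtain ⟨w, hw⟩ := hrange (LinearMap.mem_range_self f x)
    refine Submodule.mem_sup.2 ⟨x - f w, ?_, f w, LinearMap.mem_range_self f w, sub_add_cancel _ _⟩
    rw [LinearMap.mem_ker, map_sub, ← hw, Module.End.mul_apply, sub_self]

lemma exists_isCompl_ker_pow_range_pow {n m : ℕ} (hker : (f ^ n).ker = (f ^ (n + 1)).ker)
    (hrange : (f ^ m).range = (f ^ (m + 1)).range) :
    ∃ k ≠ 0, IsCompl (f ^ k).ker (f ^ k).range := by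
  refine ⟨max n m + 1, Nat.succ_ne_zero _, isCompl_ker_range ?_ ?_⟩
  · rw [← pow_add, ker_pow_eq_of_le hker (by lia : n ≤ max n m + 1 + (max n m + 1)),
      ker_pow_eq_of_le hker (by lia : n ≤ max n m + 1)]
  · rw [← pow_add, range_pow_eq_of_le hrange (by lia : m ≤ max n m + 1 + (max n m + 1)),
      range_pow_eq_of_le hrange (by lia : m ≤ max n m + 1)]

lemma bijective_add_projection_ker (h : IsCompl f.ker f.range) :
    Function.Bijective (f + f.ker.projection f.range h) := by
  set e := f.ker.projection f.range h
  have he (x : V) : f (e x) = 0 := Submodule.projection_apply_mem h x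
  have hek {x : V} (hx : f x = 0) : e x = x := Submodule.projection_apply_left h ⟨x, hx⟩
  constructor
  · refine (injective_iff_map_eq_zero _).2 fun x hx => ?_
    have hfx : f x = -e x := eq_neg_of_add_eq_zero_left hx
    have hfx0 : f x = 0 := Submodule.disjoint_def.1 h.disjoint _
      (by rw [hfx, LinearMap.mem_ker, map_neg, he, neg_zero]) (LinearMap.mem_range_self f x)
    rw [← hek hfx0, ← neg_eq_zero, ← hfx, hfx0]
  · intro y
    obtain ⟨k, hk, _, ⟨w, rfl⟩, rfl⟩ :=
      Submodule.mem_sup.1 (h.sup_eq_top ▸ Submodule.mem_top : y ∈ f.ker ⊔ f.range)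
    refine ⟨k + (w - e w), ?_⟩
    rw [LinearMap.add_apply, map_add, map_add, map_sub, map_sub, he, hek (he w), hek hk, hk,
      sub_self, sub_zero, zero_add, add_zero, add_comm]

end FittingDecomposition

section Browder

variable {X : Type u} [NormedAddCommGroup X] [NormedSpace ℂ X] {T : X →L[ℂ] X}

lemma IsDrazinInvertibleMod.isFredholm [CompleteSpace X]
    (h : IsDrazinInvertibleMod (finiteRankIdeal X) T) : T.IsFredholm := by
  obtain ⟨S, hTS, -, hJ⟩ := h
  have hrank := (mem_finiteRankIdeal.1 hJ).neg
  refine ContinuousLinearMap.IsFredholm.of_isQuasiInverse (v := S)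
    ⟨LinearMap.FiniteRangeSetoid.equiv_iff_hasFiniteRange.2 ?_,
      LinearMap.FiniteRangeSetoid.equiv_iff_hasFiniteRange.2 ?_⟩
  · have hST : S.toLinearMap ∘ₗ T.toLinearMap - .id = -(1 - T * S).toLinearMap := by
      rw [hTS.eq]
      ext x
      simp
    rwa [hST]
  · have hTS' : T.toLinearMap ∘ₗ S.toLinearMap - .id = -(1 - T * S).toLinearMap := by
      ext x
      simp
    rwa [hTS']

lemma IsDrazinInvertibleMod.pow_eq_mul {J : TwoSidedIdeal (X →L[ℂ] X)}
    (h : IsDrazinInvertibleMod J T) :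
    ∃ S n, T ^ n = T ^ (n + 1) * S ∧ T ^ n = S * T ^ (n + 1) := by
  obtain ⟨S, hTS, ⟨n, hn⟩, -⟩ := h
  rw [mul_sub, mul_one, ← mul_assoc, ← pow_succ, sub_eq_zero] at hn
  exact ⟨S, n, hn, by rwa [← (hTS.pow_left _).eq]⟩

lemma IsDrazinInvertibleMod.hasFiniteAscent {J : TwoSidedIdeal (X →L[ℂ] X)}
    (h : IsDrazinInvertibleMod J T) : HasFiniteAscent T := by
  obtain ⟨S, n, -, hS⟩ := h.pow_eq_mul
  refine ⟨n, le_antisymm ?_ ?_⟩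
  · rw [pow_succ']
    exact LinearMap.ker_le_ker_comp _ _
  · conv_rhs => rw [hS]
    exact LinearMap.ker_le_ker_comp _ _

lemma IsDrazinInvertibleMod.hasFiniteDescent {J : TwoSidedIdeal (X →L[ℂ] X)}
    (h : IsDrazinInvertibleMod J T) : HasFiniteDescent T := by
  obtain ⟨S, n, hS, -⟩ := h.pow_eq_mul
  refine ⟨n, le_antisymm ?_ ?_⟩
  · conv_lhs => rw [hS]
    exact LinearMap.range_comp_le_range _ _
  · rw [pow_succ]
    exact LinearMap.range_comp_le_range _ _

lemma isFredholm_pow [CompleteSpace X] (h : T.IsFredholm) (n : ℕ) : (T ^ n).IsFredholm := by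
  obtain ⟨S, hS⟩ := h.exists_isQuasiInverse
  refine ContinuousLinearMap.IsFredholm.of_isQuasiInverse (v := S ^ n) ?_
  induction n with
  | zero => exact (LinearEquiv.refl ℂ X).isQuasiInverse
  | succ n ih =>
    rw [pow_succ' S, pow_succ T]
    exact hS.comp ih

lemma isDrazinInvertibleMod_of_isCompl [CompleteSpace X] (hT : T.IsFredholm)
    (h : IsCompl T.ker T.range) : IsDrazinInvertibleMod (finiteRankIdeal X) T := by
  have htop := Submodule.IsCompl.isTopCompl_of_isClosed h T.isClosed_ker hT.isClosed_range
  set e : X →L[ℂ] X := T.ker.projectionL T.range htop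
  have hTe : T * e = 0 := ContinuousLinearMap.ext (Submodule.projectionL_apply_mem htop)
  have heT : e * T = 0 :=
    ContinuousLinearMap.ext fun x => Submodule.projectionL_apply_right htop ⟨T x, x, rfl⟩
  have hunit : IsUnit (T + e) :=
    ContinuousLinearMap.isUnit_iff_bijective.2 (bijective_add_projection_ker h)
  refine .of_idempotent (n := 1) ?_ (Submodule.isIdempotentElem_projectionL htop)
    (hTe.trans heT.symm) (by rw [pow_one, hTe]) ?_
  · rw [mem_finiteRankIdeal, LinearMap.hasFiniteRange_iff_range]
    have := hT.finite_ker
    rw [Submodule.range_projectionL htop]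
    exact Submodule.FG.of_finite
  · rwa [peirceGlue, mul_sub, mul_one, hTe, sub_zero, one_mul]

lemma IsBrowder.isDrazinInvertibleMod [CompleteSpace X] (h : IsBrowder T) :
    IsDrazinInvertibleMod (finiteRankIdeal X) T := by
  obtain ⟨hT, ⟨n, hn⟩, m, hm⟩ := h
  simp only [ContinuousLinearMap.toLinearMap_pow] at hn hm
  obtain ⟨k, hk, hcompl⟩ := exists_isCompl_ker_pow_range_pow hn hm
  rw [← ContinuousLinearMap.toLinearMap_pow] at hcompl
  exact (isDrazinInvertibleMod_of_isCompl (isFredholm_pow hT k) hcompl).of_pow hk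

lemma isBrowder_iff_isDrazinInvertibleMod [CompleteSpace X] :
    IsBrowder T ↔ IsDrazinInvertibleMod (finiteRankIdeal X) T :=
  ⟨IsBrowder.isDrazinInvertibleMod,
    fun h => ⟨h.isFredholm, h.hasFiniteAscent, h.hasFiniteDescent⟩⟩

lemma isDrazinInvertible_iff_isDrazinInvertibleMod :
    IsDrazinInvertible T ↔ IsDrazinInvertibleMod ⊤ T := by
  have hpow (S : X →L[ℂ] X) (n : ℕ) : T ^ n * (1 - T * S) = 0 ↔ T ^ (n + 1) * S = T ^ n := by
    rw [mul_sub, mul_one, ← mul_assoc, ← pow_succ, sub_eq_zero, eq_comm]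
  constructor
  · rintro ⟨S, hS, -, n, hn⟩
    exact ⟨S, hS, ⟨n, (hpow S n).2 hn⟩, trivial⟩
  · intro hT
    obtain ⟨S, hS, hSTS, ⟨n, hn⟩, -⟩ := hT.exists_drazinInverse
    exact ⟨S, (hS T (Commute.refl T)).symm, hSTS, n, (hpow S n).1 hn⟩

end Browder

section SigmaStar

variable {X : Type u} [NormedAddCommGroup X] [NormedSpace ℂ X]
variable {Y : Type v} [NormedAddCommGroup Y] [NormedSpace ℂ Y]
variable {s : SpectrumKind} {S : Y →L[ℂ] Y} {T : X →L[ℂ] X} {z : ℂ}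

lemma mem_sigmaStar_iff [CompleteSpace X] :
    z ∈ sigmaStar s T ↔
      ¬ IsDrazinInvertibleMod (residueIdeal s X) (T - algebraMap ℂ (X →L[ℂ] X) z) := by
  cases s with
  | full =>
    change z ∈ spectrum ℂ T ↔ ¬ IsDrazinInvertibleMod ⊥ _
    rw [isDrazinInvertibleMod_bot_iff, spectrum.mem_iff, IsUnit.sub_iff]
  | browder =>
    rw [Algebra.algebraMap_eq_smul_one]
    exact not_congr isBrowder_iff_isDrazinInvertibleMod
  | drazin =>
    rw [Algebra.algebraMap_eq_smul_one]
    exact not_congr isDrazinInvertible_iff_isDrazinInvertibleMod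

lemma sigmaStar_subset_spectrum [CompleteSpace X] (s : SpectrumKind) (T : X →L[ℂ] X) :
    sigmaStar s T ⊆ spectrum ℂ T := by
  intro z hz
  change z ∈ sigmaStar .full T
  rw [mem_sigmaStar_iff] at hz ⊢
  exact fun h => hz (h.mono bot_le)

lemma eventually_notMem_spectrum [CompleteSpace X] (hz : z ∉ sigmaStar s T) :
    ∀ᶠ y in 𝓝[≠] z, y ∉ spectrum ℂ T := by
  rw [mem_sigmaStar_iff, not_not] at hz
  have hmap := (Homeomorph.addRight z).map_punctured_nhds_eq 0
  simp only [Homeomorph.coe_addRight, zero_add] at hmap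
  rw [← hmap, eventually_map]
  filter_upwards [hz.eventually_notMem_spectrum] with y hy
  rwa [spectrum.add_mem_iff, neg_add_eq_sub]

lemma isCompact_sigmaStar [CompleteSpace X] (s : SpectrumKind) (T : X →L[ℂ] X) :
    IsCompact (sigmaStar s T) := by
  refine (spectrum.isCompact T).of_isClosed_subset ?_ (sigmaStar_subset_spectrum s T)
  rw [isClosed_iff_derivedSet_subset]
  intro z hz
  by_contra hcon
  rw [mem_derivedSet, accPt_iff_frequently_nhdsNE] at hz
  exact hz ((eventually_notMem_spectrum hcon).mono fun y hy h =>
    hy (sigmaStar_subset_spectrum s T h))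

lemma sigmaStar_pow [CompleteSpace X] (s : SpectrumKind) (T : X →L[ℂ] X) {m : ℕ} (hm : m ≠ 0) :
    sigmaStar s (T ^ m) = (· ^ m) '' sigmaStar s T := by
  ext w
  rw [mem_sigmaStar_iff, isDrazinInvertibleMod_pow_sub_iff hm]
  push Not
  simp only [mem_image, mem_sigmaStar_iff, and_comm]

lemma prodMap_sub_algebraMap (S : Y →L[ℂ] Y) (T : X →L[ℂ] X) (z : ℂ) :
    S.prodMap T - algebraMap ℂ _ z =
      (S - algebraMap ℂ _ z).prodMap (T - algebraMap ℂ _ z) := by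
  ext <;> simp [Algebra.algebraMap_eq_smul_one]

lemma sigmaStar_prodMap [CompleteSpace X] [CompleteSpace Y] (s : SpectrumKind) (S : Y →L[ℂ] Y)
    (T : X →L[ℂ] X) : sigmaStar s (S.prodMap T) = sigmaStar s S ∪ sigmaStar s T := by
  ext z
  rw [mem_union, mem_sigmaStar_iff, mem_sigmaStar_iff, mem_sigmaStar_iff, prodMap_sub_algebraMap,
    isDrazinInvertibleMod_prodMap_iff, not_and_or]

lemma sigmaStar_subset_of_retract [CompleteSpace X] [CompleteSpace Y] (s : SpectrumKind)
    (P : X →L[ℂ] Y) (Q : Y →L[ℂ] X) (hPQ : P ∘L Q = 1) (hP : P ∘L T = S ∘L P)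
    (hQ : T ∘L Q = Q ∘L S) : sigmaStar s S ⊆ sigmaStar s T := by
  intro z
  rw [mem_sigmaStar_iff, mem_sigmaStar_iff]
  refine mt fun h => h.of_retract P Q hPQ ?_ ?_
  · rw [ContinuousLinearMap.comp_sub, ContinuousLinearMap.sub_comp, hP]
    congr 1
    ext
    simp [Algebra.algebraMap_eq_smul_one]
  · rw [ContinuousLinearMap.comp_sub, ContinuousLinearMap.sub_comp, hQ]
    congr 1
    ext
    simp [Algebra.algebraMap_eq_smul_one]

lemma sigmaStar_eq_of_semiconj [CompleteSpace X] [CompleteSpace Y] (s : SpectrumKind)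
    (L : Y ≃L[ℂ] X) (h : T ∘L (L : Y →L[ℂ] X) = (L : Y →L[ℂ] X) ∘L S) :
    sigmaStar s S = sigmaStar s T := by
  have hsymm : S ∘L (L.symm : X →L[ℂ] Y) = (L.symm : X →L[ℂ] Y) ∘L T := by
    ext x
    have hx : T (L (L.symm x)) = L (S (L.symm x)) := DFunLike.congr_fun h (L.symm x)
    exact L.injective (by simpa using hx.symm)
  exact (sigmaStar_subset_of_retract s (L.symm : X →L[ℂ] Y) (L : Y →L[ℂ] X)
    (ContinuousLinearMap.ext L.symm_apply_apply) hsymm.symm h).antisymm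
    (sigmaStar_subset_of_retract s (L : Y →L[ℂ] X) (L.symm : X →L[ℂ] Y)
      (ContinuousLinearMap.ext L.apply_symm_apply) h.symm hsymm)

end SigmaStar

section Characterization

variable {X : Type u} [NormedAddCommGroup X] [NormedSpace ℂ X] {s : SpectrumKind}
  {T e : X →L[ℂ] X} {M N : Submodule ℂ X}

lemma IsRed.isTopCompl [CompleteSpace X] (h : IsRed T M N) : Submodule.IsTopCompl M N :=
  Submodule.IsCompl.isTopCompl_of_isClosed h.isCompl h.isClosed_left h.isClosed_right

lemma IsRed.sigmaStar_eq_union [CompleteSpace X] (h : IsRed T M N) (s : SpectrumKind) :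
    sigmaStar s T = sigmaStar s (T.restrict h.invariant_left) ∪
      sigmaStar s (T.restrict h.invariant_right) := by
  have := h.isClosed_left.completeSpace_coe
  have := h.isClosed_right.completeSpace_coe
  rw [← sigmaStar_prodMap]
  refine (sigmaStar_eq_of_semiconj s (M.prodEquivOfIsTopCompl N h.isTopCompl)
    (ContinuousLinearMap.ext fun x => ?_)).symm
  exact map_add T (x.1 : X) x.2

lemma isRed_ker_range (he : IsIdempotentElem e) (hTe : Commute T e) : IsRed T e.ker e.range where
  isClosed_left := e.isClosed_ker
  isClosed_right := ContinuousLinearMap.IsIdempotentElem.isClosed_range he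
  invariant_left := ((ContinuousLinearMap.IsIdempotentElem.commute_iff he).1 hTe.symm).2
  invariant_right := ((ContinuousLinearMap.IsIdempotentElem.commute_iff he).1 hTe.symm).1
  isCompl := (ContinuousLinearMap.IsIdempotentElem.isTopCompl he).isCompl.symm

lemma isUnit_restrict_ker [CompleteSpace X] (he : IsIdempotentElem e) (hTe : Commute T e)
    (hu : IsUnit (peirceGlue e T 1)) :
    IsUnit (T.restrict (isRed_ker_range he hTe).invariant_left) := by
  have hred : IsRed (peirceGlue e T 1) e.ker e.range :=
    isRed_ker_range he (commute_peirceGlue (Commute.refl e) hTe.symm (Commute.one_right e)).symm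
  have heq : T.restrict (isRed_ker_range he hTe).invariant_left =
      (peirceGlue e T 1).restrict hred.invariant_left := by
    ext x
    have hx : e x = 0 := x.2
    simp [peirceGlue, hx]
  rw [← spectrum.zero_notMem_iff ℂ] at hu ⊢
  rw [heq]
  exact fun h => hu ((hred.sigmaStar_eq_union .full).ge (Or.inl h))

lemma spectrum_restrict_range_subset [CompleteSpace X] (he : IsIdempotentElem e)
    (hTe : Commute T e) :
    spectrum ℂ (T.restrict (isRed_ker_range he hTe).invariant_right) ⊆ spectrum ℂ (T * e) := by
  have hred : IsRed (T * e) e.ker e.range :=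
    isRed_ker_range he (hTe.mul_left (Commute.refl e))
  have heq : T.restrict (isRed_ker_range he hTe).invariant_right =
      (T * e).restrict hred.invariant_right := by
    ext x
    have hx : e x = x := (LinearMap.IsIdempotentElem.mem_range_iff
      (ContinuousLinearMap.IsIdempotentElem.toLinearMap he)).1 x.2
    simp [hx]
  rw [heq]
  exact fun z hz => (hred.sigmaStar_eq_union .full).ge (Or.inr hz)

lemma countable_spectrum_diff_accIter_sigmaStar [CompleteSpace X] (s : SpectrumKind)
    (β : Ordinal.{w}) (T : X →L[ℂ] X) :
    (spectrum ℂ T \ accIter (sigmaStar s T) β).Countable := by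
  refine ((countable_diff_accIter (spectrum.isClosed T) (0 + 1 : Ordinal.{0})).union
    (countable_diff_accIter (isCompact_sigmaStar s T).isClosed β)).mono ?_
  rintro z ⟨hzT, hzβ⟩
  by_cases hz : z ∈ sigmaStar s T
  · exact Or.inr ⟨hz, hzβ⟩
  · refine Or.inl ⟨hzT, fun h => ?_⟩
    rw [accIter_add_one, accIter_zero, mem_derivedSet, accPt_iff_frequently_nhdsNE] at h
    exact h (eventually_notMem_spectrum hz)

lemma IsGInvertibleSucc.zero_notMem_accIter [CompleteSpace X] {β : Ordinal.{w}}
    (h : IsGInvertibleSucc s β T) : 0 ∉ accIter (sigmaStar s T) (β + 1) := by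
  obtain ⟨M, N, hred, hM, hN⟩ := h
  have := hred.isClosed_left.completeSpace_coe
  have := hred.isClosed_right.completeSpace_coe
  have hclosed := (isCompact_sigmaStar s (T.restrict hred.invariant_left)).isClosed
  rw [hred.sigmaStar_eq_union, accIter_union hclosed (isCompact_sigmaStar s _).isClosed, mem_union,
    not_or]
  constructor
  · exact fun h0 => spectrum.zero_notMem ℂ hM
      (sigmaStar_subset_spectrum s _ (accIter_subset hclosed _ h0))
  · rw [accIter_add_one]
    intro h0
    exact accPt_iff_frequently_nhdsNE.1 (derivedSet_mono _ _ hN h0) self_mem_nhdsWithin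

lemma isGInvertibleSucc_of_zero_notMem_accIter [CompleteSpace X] {β : Ordinal.{w}}
    (h : 0 ∉ accIter (sigmaStar s T) (β + 1)) : IsGInvertibleSucc s β T := by
  rw [accIter_add_one] at h
  obtain ⟨e, he, hTe, hu, hsp⟩ := exists_idempotent_of_zero_notMem_derivedSet h
    (countable_spectrum_diff_accIter_sigmaStar s β T)
  have hred := isRed_ker_range he hTe
  have := hred.isClosed_right.completeSpace_coe
  refine ⟨_, _, hred, isUnit_restrict_ker he hTe hu, fun z hz => hsp ⟨?_, ?_⟩⟩
  · exact spectrum_restrict_range_subset he hTe (sigmaStar_subset_spectrum s _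
      (accIter_subset (isCompact_sigmaStar s _).isClosed _ hz))
  · refine accIter_mono ?_ β hz
    rw [hred.sigmaStar_eq_union]
    exact subset_union_right

lemma isGInvertibleSucc_iff [CompleteSpace X] {β : Ordinal.{w}} :
    IsGInvertibleSucc s β T ↔ 0 ∉ accIter (sigmaStar s T) (β + 1) :=
  ⟨IsGInvertibleSucc.zero_notMem_accIter, isGInvertibleSucc_of_zero_notMem_accIter⟩

lemma isGInvertible_iff [CompleteSpace X] {α : Ordinal.{w}} :
    IsGInvertible s α T ↔ 0 ∉ accIter (sigmaStar s T) α := by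
  rcases Ordinal.zero_or_succ_or_isSuccLimit α with rfl | ⟨β, rfl⟩ | hα
  · rw [accIter_zero, IsGInvertible, Ordinal.limitRecOn_zero]
  · rw [Order.succ_eq_add_one, IsGInvertible, Ordinal.limitRecOn_add_one, isGInvertibleSucc_iff]
  · rw [IsGInvertible, Ordinal.limitRecOn_limit _ _ _ _ hα, accIter_limit _ hα]
    simp only [mem_iInter, Subtype.forall, mem_Iio, not_forall, isGInvertibleSucc_iff, exists_prop]
    constructor
    · rintro ⟨β, hβ, h⟩
      exact ⟨β + 1, hβ, h⟩
    · rintro ⟨β, hβ, h⟩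
      refine ⟨β, hα.add_one_lt hβ, mt (fun h' => ?_) h⟩
      exact accIter_antitone (isCompact_sigmaStar s T).isClosed (le_add_of_nonneg_right zero_le) h'

end Characterization

section Quasinilpotent

variable {R : Type*} [NormedRing R] [NormedAlgebra ℂ R] [CompleteSpace R]

lemma eventually_norm_pow_le_pow_of_spectrum_subset {a : R} (ha : spectrum ℂ a ⊆ {0}) {ε : ℝ}
    (hε : 0 < ε) : ∀ᶠ k : ℕ in atTop, ‖a ^ k‖ ≤ ε ^ k := by
  have hradius : spectralRadius ℂ a = 0 :=
    le_antisymm (iSup₂_le fun z hz => by rw [ha hz, nnnorm_zero, ENNReal.coe_zero]) zero_le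
  have hlim := spectrum.pow_norm_pow_one_div_tendsto_nhds_spectralRadius a
  rw [hradius] at hlim
  filter_upwards [hlim.eventually_lt_const (ENNReal.ofReal_pos.2 hε), eventually_ne_atTop 0]
    with k hk hk0
  rw [ENNReal.ofReal_lt_ofReal_iff hε, one_div] at hk
  calc ‖a ^ k‖ = (‖a ^ k‖ ^ (k⁻¹ : ℝ)) ^ k := (Real.rpow_inv_natCast_pow (norm_nonneg _) hk0).symm
    _ ≤ ε ^ k := by gcongr

lemma eq_zero_of_isIdempotentElem_mul {q b : R} (hq : spectrum ℂ q ⊆ {0}) (hqb : Commute q b)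
    (hidem : IsIdempotentElem (q * b)) : q * b = 0 := by
  obtain ⟨ε, hε, hεb⟩ := exists_pos_mul_lt one_pos ‖b‖
  rw [mul_comm] at hεb
  have hlim : Tendsto (fun k => (ε * ‖b‖) ^ k) atTop (𝓝 0) :=
    tendsto_pow_atTop_nhds_zero_of_lt_one (by positivity) hεb
  refine norm_le_zero_iff.1 (ge_of_tendsto hlim ?_)
  filter_upwards [eventually_norm_pow_le_pow_of_spectrum_subset hq hε, eventually_gt_atTop 0]
    with k hk hk0
  calc ‖q * b‖ = ‖q ^ k * b ^ k‖ := by rw [← hqb.mul_pow, hidem.pow_eq hk0.ne']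
    _ ≤ ‖q ^ k‖ * ‖b ^ k‖ := norm_mul_le _ _
    _ ≤ ε ^ k * ‖b‖ ^ k := by gcongr; exact norm_pow_le' b hk0
    _ = (ε * ‖b‖) ^ k := (mul_pow _ _ _).symm

lemma IsDrazinInvertibleMod.mem_and_pow_mul_eq_zero {J : TwoSidedIdeal R} {a e : R}
    (h : IsDrazinInvertibleMod J a) (he : IsIdempotentElem e) (hae : Commute a e)
    (hsp : spectrum ℂ (a * e) ⊆ {0}) : e ∈ J ∧ ∃ n, a ^ n * e = 0 := by
  obtain ⟨b, hb, hbab, ⟨n, hn⟩, hJ⟩ := h.exists_drazinInverse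
  have hba : Commute b a := hb a (Commute.refl a)
  have hbe : Commute b e := hb e hae
  have habe : a * e * b = a * b * e := by rw [mul_assoc, ← hbe.eq, mul_assoc]
  have hab : IsIdempotentElem (a * b) := by rw [IsIdempotentElem, mul_assoc, ← mul_assoc b, hbab]
  have hzero : a * e * b = 0 :=
    eq_zero_of_isIdempotentElem_mul hsp (hba.symm.mul_left hbe.symm)
      (habe ▸ hab.mul_of_commute (hae.mul_left hbe) he)
  have hfix : (1 - a * b) * e = e := by rw [sub_mul, ← habe, hzero, sub_zero, one_mul]
  rw [← hfix]
  exact ⟨J.mul_mem_right _ _ hJ, n, by rw [← mul_assoc, hn, zero_mul]⟩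

end Quasinilpotent

section DualAdjoint

variable {X : Type u} [NormedAddCommGroup X] [NormedSpace ℂ X] {s : SpectrumKind} {T : X →L[ℂ] X}

lemma dualAdjoint_apply (T : X →L[ℂ] X) (f : StrongDual ℂ X) (x : X) :
    dualAdjoint T f x = f (T x) :=
  rfl

lemma dualAdjoint_zero : dualAdjoint (0 : X →L[ℂ] X) = 0 :=
  ContinuousLinearMap.ext fun f => ContinuousLinearMap.ext fun _ => map_zero f

lemma dualAdjoint_one : dualAdjoint (1 : X →L[ℂ] X) = 1 :=
  rfl

lemma dualAdjoint_mul (T S : X →L[ℂ] X) :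
    dualAdjoint (T * S) = dualAdjoint S * dualAdjoint T :=
  rfl

lemma dualAdjoint_sub (T S : X →L[ℂ] X) :
    dualAdjoint (T - S) = dualAdjoint T - dualAdjoint S := by
  ext f x
  exact map_sub f (T x) (S x)

lemma dualAdjoint_smul_one (z : ℂ) : dualAdjoint (z • (1 : X →L[ℂ] X)) = z • 1 := by
  ext f x
  exact map_smul f z x

set_option synthInstance.maxHeartbeats 40000 in
-- The ring structure of the operators on `StrongDual ℂ X` is found only after a long search.
lemma dualAdjoint_pow (T : X →L[ℂ] X) (n : ℕ) : dualAdjoint (T ^ n) = dualAdjoint T ^ n := by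
  induction n with
  | zero => rfl
  | succ n ih => rw [pow_succ, dualAdjoint_mul, ih, pow_succ']

lemma commute_dualAdjoint {S : X →L[ℂ] X} (h : Commute T S) :
    Commute (dualAdjoint T) (dualAdjoint S) := by
  rw [Commute, SemiconjBy, ← dualAdjoint_mul, ← dualAdjoint_mul, h.eq]

lemma dualAdjoint_eq_zero_iff : dualAdjoint T = 0 ↔ T = 0 := by
  refine ⟨fun h => ContinuousLinearMap.ext fun x => ?_, fun h => h ▸ dualAdjoint_zero⟩
  refine SeparatingDual.eq_zero_of_forall_dual_eq_zero (R := ℂ) fun f => ?_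
  rw [← dualAdjoint_apply, h]
  rfl

lemma antilipschitzWith_of_dualAdjoint_mul_eq_one {W : StrongDual ℂ X →L[ℂ] StrongDual ℂ X}
    (h : dualAdjoint T * W = 1) : AntilipschitzWith ‖W‖₊ T := by
  refine AddMonoidHomClass.antilipschitz_of_bound T fun x => ?_
  obtain ⟨f, hf, hfx⟩ := exists_dual_vector'' ℂ x
  have hWf : W f (T x) = f x := DFunLike.congr_fun (DFunLike.congr_fun h f) x
  calc ‖x‖ = ‖W f (T x)‖ := by rw [hWf, hfx, RCLike.norm_ofReal, abs_norm]
    _ ≤ ‖W f‖ * ‖T x‖ := (W f).le_opNorm _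
    _ ≤ ‖W‖ * ‖T x‖ := by
      gcongr
      exact (W.le_opNorm f).trans (mul_le_of_le_one_right (norm_nonneg _) hf)

lemma surjective_of_injective_dualAdjoint (hclosed : IsClosed (T.range : Set X))
    (h : Function.Injective (dualAdjoint T)) : Function.Surjective T := by
  intro y
  change y ∈ T.range
  rw [← Submodule.Quotient.mk_eq_zero]
  refine SeparatingDual.eq_zero_of_forall_dual_eq_zero (R := ℂ) fun f => ?_
  have hzero : dualAdjoint T (f ∘L T.range.mkQL) = 0 := by
    ext x
    have hx : T.range.mkQL (T x) = 0 := (Submodule.Quotient.mk_eq_zero _).2 ⟨x, rfl⟩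
    exact (congrArg f hx).trans (map_zero f)
  exact DFunLike.congr_fun (h (hzero.trans (map_zero _).symm)) y

lemma isUnit_dualAdjoint_iff [CompleteSpace X] : IsUnit (dualAdjoint T) ↔ IsUnit T := by
  constructor
  · rintro ⟨V, hV⟩
    have hanti := antilipschitzWith_of_dualAdjoint_mul_eq_one (hV ▸ V.mul_inv)
    exact ContinuousLinearMap.isUnit_iff_bijective.2 ⟨hanti.injective,
      surjective_of_injective_dualAdjoint (hanti.isClosed_range T.uniformContinuous)
        (ContinuousLinearMap.isUnit_iff_bijective.1 ⟨V, hV⟩).injective⟩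
  · rintro ⟨V, rfl⟩
    exact ⟨⟨dualAdjoint V, dualAdjoint ↑V⁻¹, by rw [← dualAdjoint_mul, V.inv_mul, dualAdjoint_one],
      by rw [← dualAdjoint_mul, V.mul_inv, dualAdjoint_one]⟩, rfl⟩

lemma spectrum_dualAdjoint [CompleteSpace X] (T : X →L[ℂ] X) :
    spectrum ℂ (dualAdjoint T) = spectrum ℂ T := by
  ext z
  rw [spectrum.mem_iff, spectrum.mem_iff, Algebra.algebraMap_eq_smul_one,
    Algebra.algebraMap_eq_smul_one, ← dualAdjoint_smul_one, ← dualAdjoint_sub,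
    isUnit_dualAdjoint_iff]

lemma hasFiniteRange_dualAdjoint (h : T.toLinearMap.HasFiniteRange) :
    (dualAdjoint T).toLinearMap.HasFiniteRange := by
  have : FiniteDimensional ℂ T.range := Module.Finite.iff_fg.2 h
  have : FiniteDimensional ℂ (T.range →L[ℂ] ℂ) := inferInstance
  have hfactor : (dualAdjoint T).toLinearMap =
      (ContinuousLinearMap.precomp ℂ T.rangeRestrict).toLinearMap ∘ₗ
        (ContinuousLinearMap.precomp ℂ T.range.subtypeL).toLinearMap := rfl
  rw [hfactor]
  exact LinearMap.HasFiniteRange.of_finite_dom.comp_right _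

lemma hasFiniteRange_dualAdjoint_iff :
    (dualAdjoint T).toLinearMap.HasFiniteRange ↔ T.toLinearMap.HasFiniteRange := by
  refine ⟨fun h => ?_, hasFiniteRange_dualAdjoint⟩
  let i := NormedSpace.inclusionInDoubleDual ℂ X
  have hi : Function.Injective i := (NormedSpace.inclusionInDoubleDualLi ℂ (E := X)).injective
  have hcomp : i.toLinearMap ∘ₗ T.toLinearMap =
      (dualAdjoint (dualAdjoint T)).toLinearMap ∘ₗ i.toLinearMap := rfl
  have hbidual : (i.toLinearMap ∘ₗ T.toLinearMap).HasFiniteRange := by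
    rw [hcomp]
    exact (hasFiniteRange_dualAdjoint h).comp_right _
  rw [LinearMap.HasFiniteRange, LinearMap.range_comp] at hbidual
  exact Submodule.fg_of_fg_map_injective i.toLinearMap hi hbidual

lemma dualAdjoint_mem_residueIdeal_iff :
    dualAdjoint T ∈ residueIdeal s (StrongDual ℂ X) ↔ T ∈ residueIdeal s X := by
  cases s with
  | full => exact dualAdjoint_eq_zero_iff
  | browder =>
    exact mem_finiteRankIdeal.trans (hasFiniteRange_dualAdjoint_iff.trans mem_finiteRankIdeal.symm)
  | drazin => exact Iff.rfl

lemma isDrazinInvertibleMod_dualAdjoint (h : IsDrazinInvertibleMod (residueIdeal s X) T) :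
    IsDrazinInvertibleMod (residueIdeal s (StrongDual ℂ X)) (dualAdjoint T) := by
  obtain ⟨S, hTS, ⟨n, hn⟩, hJ⟩ := h
  have hresidue : 1 - dualAdjoint T * dualAdjoint S = dualAdjoint (1 - T * S) := by
    rw [hTS.eq, dualAdjoint_sub, dualAdjoint_mul, dualAdjoint_one]
  have hcomm : Commute (T ^ n) (1 - T * S) :=
    (Commute.one_right _).sub_right (((Commute.refl T).mul_right hTS).pow_left n)
  refine ⟨dualAdjoint S, commute_dualAdjoint hTS, ⟨n, ?_⟩, ?_⟩
  · rw [hresidue, ← dualAdjoint_pow, ← dualAdjoint_mul, ← hcomm.eq, hn, dualAdjoint_zero]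
  · rw [hresidue]
    exact dualAdjoint_mem_residueIdeal_iff.2 hJ

/- A Drazin inverse of `T*` is not known to be an adjoint, so a candidate is built on `X`: zero is
at most an isolated point of `σ(T) = σ(T*)`, and the adjoint of the Riesz idempotent of `T` at zero
lies below the spectral idempotent of `T*`. -/
lemma isDrazinInvertibleMod_of_dualAdjoint [CompleteSpace X]
    (h : IsDrazinInvertibleMod (residueIdeal s (StrongDual ℂ X)) (dualAdjoint T)) :
    IsDrazinInvertibleMod (residueIdeal s X) T := by
  have hisolated : 0 ∉ derivedSet (spectrum ℂ T) := by
    rw [mem_derivedSet, accPt_iff_frequently_nhdsNE, not_frequently, ← spectrum_dualAdjoint]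
    exact h.eventually_notMem_spectrum
  obtain ⟨e, he, hTe, hu, hsp⟩ := exists_idempotent_of_zero_notMem_derivedSet hisolated
    (by rw [sdiff_self]; exact countable_empty)
  have hsp0 : spectrum ℂ (T * e) ⊆ {0} := fun z hz =>
    (spectrum_mul_idempotent_subset he hTe hz).elim id fun hzT => hsp ⟨hz, hzT⟩
  have hdual : Commute (dualAdjoint T) (dualAdjoint e) := commute_dualAdjoint hTe
  obtain ⟨heJ, n, hn⟩ := h.mem_and_pow_mul_eq_zero (e := dualAdjoint e)
    (by rw [IsIdempotentElem, ← dualAdjoint_mul, he.eq]) hdual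
    (by rwa [hdual.eq, ← dualAdjoint_mul, spectrum_dualAdjoint])
  refine .of_idempotent (dualAdjoint_mem_residueIdeal_iff.1 heJ) he hTe (n := n) ?_ hu
  rw [(hTe.pow_left n).eq, ← dualAdjoint_eq_zero_iff, dualAdjoint_mul, dualAdjoint_pow, hn]

lemma sigmaStar_dualAdjoint [CompleteSpace X] (s : SpectrumKind) (T : X →L[ℂ] X) :
    sigmaStar s (dualAdjoint T) = sigmaStar s T := by
  ext z
  rw [mem_sigmaStar_iff, mem_sigmaStar_iff, Algebra.algebraMap_eq_smul_one,
    Algebra.algebraMap_eq_smul_one, ← dualAdjoint_smul_one, ← dualAdjoint_sub]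
  exact not_congr ⟨isDrazinInvertibleMod_of_dualAdjoint, isDrazinInvertibleMod_dualAdjoint⟩

end DualAdjoint

section Permanence

variable {X : Type u} [NormedAddCommGroup X] [NormedSpace ℂ X] [CompleteSpace X]
variable {Y : Type v} [NormedAddCommGroup Y] [NormedSpace ℂ Y] [CompleteSpace Y]
variable (s : SpectrumKind) (α : Ordinal.{w}) (S : Y →L[ℂ] Y) (T : X →L[ℂ] X)

theorem isGInvertible_dualAdjoint_iff :
    IsGInvertible s α (dualAdjoint T) ↔ IsGInvertible s α T := by
  rw [isGInvertible_iff, isGInvertible_iff, sigmaStar_dualAdjoint]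

theorem isGInvertible_prodMap_iff :
    IsGInvertible s α (S.prodMap T) ↔ IsGInvertible s α S ∧ IsGInvertible s α T := by
  rw [isGInvertible_iff, isGInvertible_iff, isGInvertible_iff, sigmaStar_prodMap,
    accIter_union (isCompact_sigmaStar s S).isClosed (isCompact_sigmaStar s T).isClosed, mem_union,
    not_or]

theorem isGInvertible_pow_iff {m : ℕ} (hm : m ≠ 0) :
    IsGInvertible s α (T ^ m) ↔ IsGInvertible s α T := by
  rw [isGInvertible_iff, isGInvertible_iff, sigmaStar_pow s T hm,
    accIter_image_pow (isCompact_sigmaStar s T) hm, mem_image]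
  simp only [pow_eq_zero_iff hm, exists_eq_right]

end Permanence

end GInv

theorem mainTheorem9 {X : Type u} [NormedAddCommGroup X] [NormedSpace ℂ X] [CompleteSpace X]
    (s : GInv.SpectrumKind) (α : Ordinal.{w}) (T : X →L[ℂ] X) :
    (GInv.IsGInvertible s α T ↔ GInv.IsGInvertible s α (GInv.dualAdjoint T)) ∧
    (∀ {Y : Type v} [NormedAddCommGroup Y] [NormedSpace ℂ Y] [CompleteSpace Y] (S : Y →L[ℂ] Y),
      GInv.IsGInvertible s α (S.prodMap T) ↔
        GInv.IsGInvertible s α S ∧ GInv.IsGInvertible s α T) ∧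
    (GInv.IsGInvertible s α T ↔ ∃ m : ℕ, 1 ≤ m ∧ GInv.IsGInvertible s α (T ^ m)) ∧
    (GInv.IsGInvertible s α T ↔ ∀ m : ℕ, 1 ≤ m → GInv.IsGInvertible s α (T ^ m)) := by
  refine ⟨(GInv.isGInvertible_dualAdjoint_iff s α T).symm,
    fun S => GInv.isGInvertible_prodMap_iff s α S T, ?_, ?_⟩
  · refine ⟨fun h => ⟨1, le_rfl, by rwa [pow_one]⟩, ?_⟩
    rintro ⟨m, hm, h⟩
    exact (GInv.isGInvertible_pow_iff s α T (Nat.one_le_iff_ne_zero.1 hm)).1 h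
  · exact ⟨fun h m hm => (GInv.isGInvertible_pow_iff s α T (Nat.one_le_iff_ne_zero.1 hm)).2 h,
      fun h => pow_one T ▸ h 1 le_rfl⟩
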